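/- Let $Y$ be a connected Riemann surface with holomorphic cotangent bundle $K_Y$, let $S \subset Y$ be a finite subset, and let $y \in S$. Let $E$ be a holomorphic vector bundle of rank two on $Y$, and let $$D : E \longrightarrow E\otimes K_Y\otimes \mathcal{O}_Y(S)$$ be a logarithmic connection on $E$ singular over $S$, i.e. an additive operator on local holomorphic sections with $D(fs) = f\,D(s) + s\otimes df$ for all local holomorphic functions $f$ and local holomorphic sections $s$ of $E$. Let $\mathrm{Res}(D,y)\in \mathrm{End}(E_y)$ be its residue at $y$: if $z$ is a holomorphic coordinate with $z(y)=0$ and $s$ is a holomorphic section of $E$ around $y$, then $\mathrm{Res}(D,y)(s(y))$ is the vector $v\in E_y$ such that the holomorphic section $z\,D(s)$ of $E\otimes K_Y$ around $y$ has the value $v\otimes dz$ at $y$. Assume that $\mathrm{Res}(D,y)$ has the two eigenvalues $-1$ and $0$, and let $\ell_1\subset E_y$ and $\ell_0\subset E_y$ be the eigenlines for $-1$ and $0$ respectively, so that $E_y=\ell_0\oplus\ell_1$. Then the following hold. 1. There is a unique homomorphism $\rho(D,y) : \ell_0 \to \ell_1\otimes (K_Y)_y$ with the following property. For every $\alpha\in\ell_0$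 and every holomorphic section $s$ of $E$ on an open neighbourhood of $y$ with $s(y)=\alpha$, the section $D(s)$ of $E\otimes K_Y\otimes\mathcal{O}_Y(S)$ is, around $y$, a holomorphic section of $E\otimes K_Y$, and the component in $\ell_1\otimes (K_Y)_y$ of its value at $y$, with respect to the decomposition $(E\otimes K_Y)_y = (\ell_0\otimes (K_Y)_y)\oplus(\ell_1\otimes (K_Y)_y)$, is $\rho(D,y)(\alpha)$. In particular this component depends only on $\alpha$ and not on the choice of $s$. 2. The local monodromy of $D$ around $y$ is trivial if and only if $\rho(D,y)=0$. Here the local monodromy is given as follows: for every holomorphic coordinate $z$ around $y$ with $z(y)=0$ and every sufficiently small $r>0$ (depending on $z$), parallel transport (continuation of flat holomorphic sections of $E$ over open subsets of $Y\setminus S$) along the loop $t\mapsto z^{-1}(re^{2\pi i t})$, $0\le t\le 1$, is a well-defined linear endomorphism $T$ of the fibre of $E$ over the base point of the loop; the local monodromy is trivial if $T$ is the identity. The equivalence holds for each of these loops. -/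

import Mathlib

open Bundle Filter Topology
open scoped Manifold ContDiff TensorProduct

noncomputable section

namespace LogConn

variable {Y : Type*} [TopologicalSpace Y] [ChartedSpace ℂ Y]

/-- `φ` is a holomorphic coordinate function on the Riemann surface `Y`, defined around `y`
and vanishing at `y`. -/
structure IsCoordAt (φ : OpenPartialHomeomorph Y ℂ) (y : Y) : Prop where
  mem_atlas : φ ∈ IsManifold.maximalAtlas 𝓘(ℂ) ω Y
  mem_source : y ∈ φ.source
  map_eq_zero : φ y = 0

/-- The fibre at `y` of the holomorphic cotangent bundle of `Y`. -/
abbrev Cotangent (y : Y) : Type := Module.Dual ℂ (TangentSpace 𝓘(ℂ) y)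

/-- The canonical map `W ⊗ (K_Y)_y → Hom(T_y Y, W)`, sending `w ⊗ ξ` to `v ↦ ξ(v) w`. -/
def toHom {W : Type*} [AddCommGroup W] [Module ℂ W] (y : Y) :
    W ⊗[ℂ] Cotangent y →ₗ[ℂ] (TangentSpace 𝓘(ℂ) y →ₗ[ℂ] W) :=
  dualTensorHom ℂ (TangentSpace 𝓘(ℂ) y) W ∘ₗ
    (TensorProduct.comm ℂ W (Cotangent y)).toLinearMap

variable [IsManifold 𝓘(ℂ) ω Y]
  (F : Type*) [NormedAddCommGroup F] [NormedSpace ℂ F]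
  {E : Y → Type*} [TopologicalSpace (TotalSpace F E)]
  [∀ x, AddCommGroup (E x)] [∀ x, Module ℂ (E x)] [∀ x, TopologicalSpace (E x)]
  [∀ x, IsTopologicalAddGroup (E x)] [∀ x, ContinuousSMul ℂ (E x)]
  [FiberBundle F E]

/-- The section `s` of the bundle `E` is holomorphic on `U` (its values outside `U` play
no role). -/
def HolSection (U : Set Y) (s : Π x, E x) : Prop :=
  ContMDiffOn 𝓘(ℂ) (𝓘(ℂ).prod 𝓘(ℂ, F)) ω (fun x ↦ TotalSpace.mk' F x (s x)) U

variable [VectorBundle ℂ F E]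

/-- The `E`-valued one-form `η`, that is, the section `η` of `E ⊗ K_Y = Hom(TY, E)`, is
holomorphic on `U`. -/
def HolForm (U : Set Y) (η : Π x, TangentSpace 𝓘(ℂ) x →L[ℂ] E x) : Prop :=
  ContMDiffOn 𝓘(ℂ) (𝓘(ℂ).prod 𝓘(ℂ, ℂ →L[ℂ] F)) ω
    (fun x ↦ TotalSpace.mk' (E := fun x ↦ TangentSpace 𝓘(ℂ) x →L[ℂ] E x) (ℂ →L[ℂ] F) x (η x)) U

/-- The `E`-valued one-form `η`, defined on a punctured neighbourhood of `y`, extends to a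
holomorphic `E`-valued one-form around `y`, and the extension takes the value `θ` at `y`. -/
def ExtendsAt (η : Π x, TangentSpace 𝓘(ℂ) x →L[ℂ] E x) (y : Y)
    (θ : TangentSpace 𝓘(ℂ) y →L[ℂ] E y) : Prop :=
  ∃ U : Set Y, IsOpen U ∧ y ∈ U ∧ ∃ ζ : Π x, TangentSpace 𝓘(ℂ) x →L[ℂ] E x,
    HolForm F U ζ ∧ (∀ x ∈ U, x ≠ y → ζ x = η x) ∧ ζ y = θ

/-- `η` is a section over the open set `U` of `E ⊗ K_Y ⊗ 𝒪_Y(S)`: a holomorphic `E`-valued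
one-form on `U ∖ S` with at most simple poles at the points of `S`, i.e. `z η` is holomorphic
around `y` for every `y ∈ U ∩ S` and every coordinate `z` vanishing at `y`. The values of `η` at
the points of `S` play no role. -/
def IsLogForm (S : Finset Y) (U : Set Y) (η : Π x, TangentSpace 𝓘(ℂ) x →L[ℂ] E x) : Prop :=
  HolForm F (U \ (S : Set Y)) η ∧
    ∀ y ∈ U, y ∈ S → ∀ φ : OpenPartialHomeomorph Y ℂ, IsCoordAt φ y →
      ∃ θ, ExtendsAt F (fun x ↦ φ x • η x) y θ

/-- The `E`-valued one-form `η`, with at most a simple pole at `y`, has residue `v ∈ E_y` at `y`: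
for a coordinate `z` vanishing at `y`, the holomorphic form `z η` has the value `dz ⊗ v` at `y`,
i.e. the class of `η` in `(E ⊗ K_Y ⊗ 𝒪_Y(S))_y` is `v ⊗ dz / z`. -/
def HasResidue (η : Π x, TangentSpace 𝓘(ℂ) x →L[ℂ] E x) (y : Y) (v : E y) : Prop :=
  ∀ φ : OpenPartialHomeomorph Y ℂ, IsCoordAt φ y →
    ExtendsAt F (fun x ↦ φ x • η x) y ((mvfderiv 𝓘(ℂ) φ y).smulRight v)

variable (E) in
/-- A logarithmic connection on the holomorphic vector bundle `E`, singular over the finite set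
`S`: an operator `D` on local sections which is additive and satisfies the Leibniz rule
`D (f s) = f D s + s ⊗ df` away from `S`, and which sends holomorphic sections of `E` over an open
set `U` to sections of `E ⊗ K_Y ⊗ 𝒪_Y(S)` over `U`.

Local sections are represented by arbitrary functions on `Y`; the value of `D s` at a point
outside `S` depends only on the germ of `s` at this point, by
`IsCovariantDerivativeOn.congr_of_eventuallyEq`. -/
structure LogConnection (S : Finset Y) where
  /-- The differential operator. -/
  D : (Π x, E x) → Π x, TangentSpace 𝓘(ℂ) x →L[ℂ] E x
  isCov : IsCovariantDerivativeOn F D (S : Set Y)ᶜ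
  isLogForm : ∀ (U : Set Y) (s : Π x, E x), IsOpen U → HolSection F U s → IsLogForm F S U (D s)

variable {F} {S : Finset Y}

namespace LogConnection

/-- `R` is the endomorphism of `E_y` induced by the composition of `D` with taking the residue
at `y`: it maps `s y` to the residue at `y` of `D s`, for every holomorphic section `s` of `E`
around `y`. -/
def IsResidue (D : LogConnection F E S) (y : Y) (R : E y →ₗ[ℂ] E y) : Prop :=
  ∀ (U : Set Y) (s : Π x, E x), IsOpen U → y ∈ U → HolSection F U s →
    HasResidue F (D.D s) y (R (s y))

open Classical in
/-- The residue `Res(D, y) : E_y → E_y`. -/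
def residue (D : LogConnection F E S) (y : Y) : Module.End ℂ (E y) :=
  if h : ∃ R : E y →ₗ[ℂ] E y, D.IsResidue y R then h.choose else 0

/-- `ρ : ℓ₀ → ℓ₁ ⊗ (K_Y)_y` is obtained from `D` as follows: for every `α ∈ ℓ₀` and every
holomorphic section `s` of `E` around `y` with `s y = α`, the section `D s` of
`E ⊗ K_Y ⊗ 𝒪_Y(S)` around `y` is a section of `E ⊗ K_Y`, and the component in `ℓ₁ ⊗ (K_Y)_y`,
with respect to `(E ⊗ K_Y)_y = (ℓ₀ ⊗ (K_Y)_y) ⊕ (ℓ₁ ⊗ (K_Y)_y)`, of the value `θ` at `y` of this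
section of `E ⊗ K_Y` is `ρ α`. The last condition says that `θ - ρ α` lies in
`ℓ₀ ⊗ (K_Y)_y = Hom(T_y Y, ℓ₀)`. -/
def InducesHom (D : LogConnection F E S) (y : Y) (ℓ₀ ℓ₁ : Submodule ℂ (E y))
    (ρ : ℓ₀ →ₗ[ℂ] ℓ₁ ⊗[ℂ] Cotangent y) : Prop :=
  ∀ (α : ℓ₀) (U : Set Y) (s : Π x, E x), IsOpen U → y ∈ U → HolSection F U s → s y = α →
    ∃ θ : TangentSpace 𝓘(ℂ) y →L[ℂ] E y, ExtendsAt F (D.D s) y θ ∧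
      ∀ v : TangentSpace 𝓘(ℂ) y, θ v - (toHom y (ρ α) v : E y) ∈ ℓ₀

/-- `s` is a flat holomorphic section of `E` over `U`, with `U` disjoint from `S`. -/
structure IsFlat (D : LogConnection F E S) (U : Set Y) (s : Π x, E x) : Prop where
  disjoint : Disjoint U (S : Set Y)
  hol : HolSection F U s
  flat : ∀ x ∈ U, D.D s x = 0

/-- `σ`, a curve in the total space of `E`, is a parallel section of `E` along the path
`γ : [0,1] → Y ∖ S`: locally on `[0,1]` it is the restriction to `γ` of a flat holomorphic section
of `E` on an open subset of `Y ∖ S`. -/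
def IsParallelAlong (D : LogConnection F E S) (γ : ℝ → Y) (σ : ℝ → TotalSpace F E) : Prop :=
  ∀ t₀ ∈ Set.Icc (0 : ℝ) 1, ∃ (U : Set Y) (s : Π x, E x), IsOpen U ∧ γ t₀ ∈ U ∧ D.IsFlat U s ∧
    ∀ᶠ t in 𝓝[Set.Icc (0 : ℝ) 1] t₀, σ t = TotalSpace.mk' F (γ t) (s (γ t))

/-- `T` is the monodromy of `D` along the loop `γ : [0,1] → Y ∖ S`: every vector `v` in the fibre
over the base point `γ 0` is the initial value of a parallel section along `γ` with final
value `T v`. -/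
def IsMonodromy (D : LogConnection F E S) (γ : ℝ → Y) (T : E (γ 0) →ₗ[ℂ] E (γ 0)) : Prop :=
  ∀ v : E (γ 0), ∃ σ : ℝ → TotalSpace F E, D.IsParallelAlong γ σ ∧
    σ 0 = TotalSpace.mk' F (γ 0) v ∧ σ 1 = TotalSpace.mk' F (γ 0) (T v)

end LogConnection

/-- The loop `t ↦ z⁻¹(r e^{2πit})`, `0 ≤ t ≤ 1`, going once around the zero of the
coordinate `z = φ` in the positive direction. -/
def circleLoop (φ : OpenPartialHomeomorph Y ℂ) (r : ℝ) (t : ℝ) : Y :=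
  φ.symm (circleMap 0 r (2 * Real.pi * t))

end LogConn

end

/-!
In a coordinate `z` centred at `y` and a local trivialization of `E`, the connection is
`D = d + A(z) dz/z` with `A` holomorphic and `A(0)` the residue
(`LogConnection.exists_hasConnectionMatrix`). The eigenvalues of `A(0)` being `0` and `-1`, it
satisfies `A(0)² = -A(0)`; the projections to `ℓ₀` and `ℓ₁` are `1 + A(0)` and `-A(0)`.

If `s(0) = α ∈ ℓ₀`, then `D(s) = (s' + A(z) s / z) dz` has at `z = 0` the value
`(s'(0) + A(0) s'(0) + A'(0) α) dz`. The first two terms add up to an element of `ℓ₀`, so the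
component in `ℓ₁` is `-A(0) A'(0) α dz`. This is the homomorphism `ρ`, and in the trivialization
it is given by `N = -A(0) A'(0) (1 + A(0))` (`HasConnectionMatrix.exists_inducesHom`).

For the monodromy, the eigenvalues of the residue differ by an integer, so `D` is resonant. The
change of frame `1 + A(0) - z A(0)`, which multiplies the `ℓ₁`-part by `z`, raises the eigenvalue
`-1` to `0` and leaves a connection with residue `N` (`exists_shearing`). Now `N² = 0`, no two
eigenvalues of the residue differ by a nonzero integer, and a convergent power series carries the
connection to `d + N dz/z` (`exists_gauge`). Hence, in terms of `w = log z`, there is a fundamental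
solution `Φ(w)` with `Φ(w + 2πi) = Φ(w) (1 - 2πi N)` (`exists_fundamentalSolution`). The parallel
sections along the circle `|z| = r` are exactly `Φ(log r + 2πit) v`
(`LogConnection.IsParallelAlong.apply_one`, `isParallelAlong_circleLoop`), so that parallel
transport is conjugate to `1 - 2πi N`, and it is trivial iff `N = 0`, i.e. iff `ρ = 0`
(`monodromy_circleLoop`).
-/

noncomputable section

namespace LogConn

/-! ### A linear differential equation with a regular singular point -/

section RegularSingular

variable {𝔸 : Type*} [NormedRing 𝔸] [NormedAlgebra ℂ 𝔸]

/-- For `N * N = 0`, the solution `p` of the equation `n p + N p - p N = x`, `n ≠ 0`: since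
`ad N` has vanishing cube, the inverse of `n + ad N` is a finite geometric series. -/
def adShiftInv (N : 𝔸) (n : ℕ) (x : 𝔸) : 𝔸 :=
  (n : ℂ)⁻¹ • x - ((n : ℂ)⁻¹ ^ 2) • (N * x - x * N) - (2 * (n : ℂ)⁻¹ ^ 3) • (N * x * N)

lemma adShiftInv_spec {N : 𝔸} (hN : N * N = 0) {n : ℕ} (hn : n ≠ 0) (x : 𝔸) :
    (n : ℂ) • adShiftInv N n x + N * adShiftInv N n x - adShiftInv N n x * N = x := by
  have hn' : (n : ℂ) ≠ 0 := Nat.cast_ne_zero.2 hn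
  have h1 : ∀ y : 𝔸, N * (N * y) = 0 := fun y ↦ by rw [← mul_assoc, hN, zero_mul]
  have h2 : ∀ y : 𝔸, y * N * N = 0 := fun y ↦ by rw [mul_assoc, hN, mul_zero]
  simp only [adShiftInv, mul_sub, sub_mul, smul_sub, mul_smul_comm, smul_mul_assoc, smul_smul,
    h1, h2, ← mul_assoc, zero_mul, smul_zero]
  have e1 : (n : ℂ) * (n : ℂ)⁻¹ = 1 := mul_inv_cancel₀ hn'
  have e2 : (n : ℂ) * (n : ℂ)⁻¹ ^ 2 = (n : ℂ)⁻¹ := by field_simp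
  have e3 : (n : ℂ) * 2 * (n : ℂ)⁻¹ ^ 3 = 2 * (n : ℂ)⁻¹ ^ 2 := by field_simp
  rw [e1, e2, e3, one_smul]
  module

lemma norm_adShiftInv_le (N : 𝔸) {n : ℕ} (hn : n ≠ 0) (x : 𝔸) :
    ‖adShiftInv N n x‖ ≤ (1 + 2 * ‖N‖ + 2 * ‖N‖ ^ 2) * ‖x‖ := by
  have hn1 : ‖(n : ℂ)⁻¹‖ ≤ 1 := by
    rw [norm_inv, Complex.norm_natCast]
    exact inv_le_one_of_one_le₀ (by exact_mod_cast Nat.one_le_iff_ne_zero.2 hn)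
  have a1 : ‖(n : ℂ)⁻¹ • x‖ ≤ ‖x‖ := by
    rw [norm_smul]; exact mul_le_of_le_one_left (norm_nonneg _) hn1
  have a2 : ‖((n : ℂ)⁻¹ ^ 2) • (N * x - x * N)‖ ≤ 2 * ‖N‖ * ‖x‖ := by
    rw [norm_smul, norm_pow]
    refine (mul_le_of_le_one_left (norm_nonneg _) (pow_le_one₀ (norm_nonneg _) hn1)).trans ?_
    refine (norm_sub_le _ _).trans ?_
    linarith [norm_mul_le N x, norm_mul_le x N]
  have a3 : ‖(2 * (n : ℂ)⁻¹ ^ 3) • (N * x * N)‖ ≤ 2 * ‖N‖ ^ 2 * ‖x‖ := by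
    rw [norm_smul, norm_mul, norm_pow]
    have h3 : ‖(n : ℂ)⁻¹‖ ^ 3 ≤ 1 := pow_le_one₀ (norm_nonneg _) hn1
    have h4 : ‖N * x * N‖ ≤ ‖N‖ * ‖x‖ * ‖N‖ :=
      (norm_mul_le _ _).trans (mul_le_mul_of_nonneg_right (norm_mul_le _ _) (norm_nonneg _))
    calc ‖(2 : ℂ)‖ * ‖(n : ℂ)⁻¹‖ ^ 3 * ‖N * x * N‖ ≤ 2 * 1 * (‖N‖ * ‖x‖ * ‖N‖) := by
          rw [Complex.norm_ofNat]; gcongr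
      _ = 2 * ‖N‖ ^ 2 * ‖x‖ := by ring
  calc ‖adShiftInv N n x‖ ≤ ‖x‖ + 2 * ‖N‖ * ‖x‖ + 2 * ‖N‖ ^ 2 * ‖x‖ :=
        (norm_sub_le _ _).trans (add_le_add ((norm_sub_le _ _).trans (add_le_add a1 a2)) a3)
    _ = _ := by ring

/-- The coefficients of the formal solution `P = ∑ pₙ zⁿ`, `p₀ = 1`, of `z P' = -B P + P b₀`,
where `B = ∑ bₙ zⁿ`. -/
def gaugeCoeff (b : ℕ → 𝔸) : ℕ → 𝔸
  | 0 => 1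
  | n + 1 => adShiftInv (b 0) (n + 1) (-∑ k : Fin (n + 1), b (k + 1) * gaugeCoeff b (n - k))

lemma gaugeCoeff_zero (b : ℕ → 𝔸) : gaugeCoeff b 0 = 1 := by rw [gaugeCoeff]

lemma gaugeCoeff_succ (b : ℕ → 𝔸) (n : ℕ) : gaugeCoeff b (n + 1) =
    adShiftInv (b 0) (n + 1)
      (-∑ k ∈ Finset.range (n + 1), b (k + 1) * gaugeCoeff b (n - k)) := by
  rw [gaugeCoeff, Finset.sum_range]

lemma gaugeCoeff_rec {b : ℕ → 𝔸} (hb : b 0 * b 0 = 0) (n : ℕ) :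
    (n : ℂ) • gaugeCoeff b n =
      -∑ k ∈ Finset.range (n + 1), b k * gaugeCoeff b (n - k) + gaugeCoeff b n * b 0 := by
  cases n with
  | zero => simp [gaugeCoeff_zero]
  | succ n =>
    have h := adShiftInv_spec hb (Nat.succ_ne_zero n)
      (-∑ k ∈ Finset.range (n + 1), b (k + 1) * gaugeCoeff b (n - k))
    rw [Nat.succ_eq_add_one, ← gaugeCoeff_succ] at h
    rw [Finset.sum_range_succ']
    simp only [Nat.add_sub_add_right, Nat.sub_zero, neg_add]
    rw [← h]
    abel

/-- The formal solution has a positive radius of convergence. -/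
lemma exists_norm_gaugeCoeff_le {b : ℕ → 𝔸} {M K : ℝ} (hM : 0 < M) (hK : 0 < K)
    (hb : ∀ n, ‖b n‖ ≤ M * K ^ n) : ∃ L > K, ∀ n, ‖gaugeCoeff b n‖ ≤ ‖(1 : 𝔸)‖ * L ^ n := by
  set G := 1 + 2 * ‖b 0‖ + 2 * ‖b 0‖ ^ 2
  have hG : 0 < G := by positivity
  have hKGM : 0 < K * G * M := by positivity
  -- `L` is chosen so that `G * M * K / (L - K) = 1`, which closes the induction.
  refine ⟨K + K * G * M, by linarith, fun n ↦ ?_⟩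
  set L := K + K * G * M with hL
  have hL0 : 0 < L := by positivity
  induction n using Nat.strong_induction_on with
  | _ n ih =>
    cases n with
    | zero => simp [gaugeCoeff_zero]
    | succ n =>
      rw [gaugeCoeff_succ]
      refine (norm_adShiftInv_le _ n.succ_ne_zero _).trans ?_
      rw [norm_neg]
      have h1 : ‖∑ k ∈ Finset.range (n + 1), b (k + 1) * gaugeCoeff b (n - k)‖ ≤
          ∑ k ∈ Finset.range (n + 1), M * K * ‖(1 : 𝔸)‖ * (K ^ k * L ^ (n + 1 - 1 - k)) := by
        refine norm_sum_le_of_le _ fun k hk ↦ (norm_mul_le _ _).trans ?_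
        calc ‖b (k + 1)‖ * ‖gaugeCoeff b (n - k)‖
            ≤ (M * K ^ (k + 1)) * (‖(1 : 𝔸)‖ * L ^ (n - k)) :=
              mul_le_mul (hb _) (ih _ (by omega)) (norm_nonneg _) (by positivity)
          _ = _ := by rw [Nat.add_sub_cancel]; ring
      have h2 : (∑ k ∈ Finset.range (n + 1), K ^ k * L ^ (n + 1 - 1 - k)) * (K * G * M) ≤
          L ^ (n + 1) := by
        have := (Commute.all K L).geom_sum₂_mul (n + 1)
        have hKL : K - L = -(K * G * M) := by rw [hL]; ring
        rw [hKL] at this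
        have : 0 ≤ K ^ (n + 1) := by positivity
        linarith
      calc G * ‖∑ k ∈ Finset.range (n + 1), b (k + 1) * gaugeCoeff b (n - k)‖
          ≤ G * ∑ k ∈ Finset.range (n + 1), M * K * ‖(1 : 𝔸)‖ * (K ^ k * L ^ (n + 1 - 1 - k)) :=
            mul_le_mul_of_nonneg_left h1 hG.le
        _ = ‖(1 : 𝔸)‖ *
            ((∑ k ∈ Finset.range (n + 1), K ^ k * L ^ (n + 1 - 1 - k)) * (K * G * M)) := by
            rw [← Finset.mul_sum]; ring
        _ ≤ _ := mul_le_mul_of_nonneg_left h2 (norm_nonneg _)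

/-- A system `z P' = -B P` whose residue `B 0` has square zero is gauge equivalent, by a
holomorphic gauge transformation `P`, to the system with constant coefficients `B 0`. -/
theorem exists_gauge [CompleteSpace 𝔸] {B : ℂ → 𝔸} (hB : AnalyticAt ℂ B 0)
    (hN : B 0 * B 0 = 0) :
    ∃ P : ℂ → 𝔸, AnalyticAt ℂ P 0 ∧ P 0 = 1 ∧
      ∀ᶠ z in 𝓝 0, z • deriv P z = -(B z * P z) + P z * B 0 := by
  obtain ⟨p, hp⟩ := hB
  obtain ⟨M, K, hM, hK, hpM⟩ := p.le_mul_pow_of_radius_pos hp.radius_pos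
  set b : ℕ → 𝔸 := p.coeff with hb
  have hb0 : b 0 = B 0 := hp.coeff_zero _
  have hbM : ∀ n, ‖b n‖ ≤ M * K ^ n := fun n ↦ by
    rw [hb, ← FormalMultilinearSeries.norm_apply_eq_norm_coef]; exact hpM n
  obtain ⟨L, hKL, hL⟩ := exists_norm_gaugeCoeff_le hM hK hbM
  have hL0 : 0 < L := hK.trans hKL
  set c := gaugeCoeff b with hc
  set U : Set ℂ := Metric.ball 0 (1 / (2 * L)) with hU
  have hzL : ∀ z ∈ U, L * ‖z‖ ≤ 1 / 2 := fun z hz ↦ by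
    rw [hU, mem_ball_zero_iff, lt_div_iff₀ (by positivity)] at hz; linarith
  have hsum : Summable fun n : ℕ ↦ ‖(1 : 𝔸)‖ * (1 / 2 : ℝ) ^ n :=
    (summable_geometric_of_lt_one (by norm_num) (by norm_num)).mul_left _
  have hsum' : Summable fun n : ℕ ↦ M * (1 / 2 : ℝ) ^ n :=
    (summable_geometric_of_lt_one (by norm_num) (by norm_num)).mul_left _
  have hcle : ∀ (n : ℕ) (z : ℂ), z ∈ U → ‖z ^ n • c n‖ ≤ ‖(1 : 𝔸)‖ * (1 / 2 : ℝ) ^ n :=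
    fun n z hz ↦ by
      rw [norm_smul, norm_pow]
      calc ‖z‖ ^ n * ‖c n‖ ≤ ‖z‖ ^ n * (‖(1 : 𝔸)‖ * L ^ n) := by gcongr; exact hL n
        _ = ‖(1 : 𝔸)‖ * (L * ‖z‖) ^ n := by rw [mul_pow]; ring
        _ ≤ _ := by gcongr; exact hzL z hz
  have hble : ∀ (n : ℕ) (z : ℂ), z ∈ U → ‖z ^ n • b n‖ ≤ M * (1 / 2 : ℝ) ^ n :=
    fun n z hz ↦ by
      rw [norm_smul, norm_pow]
      calc ‖z‖ ^ n * ‖b n‖ ≤ ‖z‖ ^ n * (M * K ^ n) := by gcongr; exact hbM n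
        _ = M * (K * ‖z‖) ^ n := by rw [mul_pow]; ring
        _ ≤ _ := by
          gcongr
          exact (mul_le_mul_of_nonneg_right hKL.le (norm_nonneg z)).trans (hzL z hz)
  have hUo : IsOpen U := Metric.isOpen_ball
  have hU0 : (0 : ℂ) ∈ U := Metric.mem_ball_self (by positivity)
  have hdiff : ∀ n : ℕ, DifferentiableOn ℂ (fun z : ℂ ↦ z ^ n • c n) U := fun n ↦ by fun_prop
  refine ⟨fun z ↦ ∑' n, z ^ n • c n, ?_, ?_, ?_⟩
  · exact (Complex.differentiableOn_tsum_of_summable_norm hsum hdiff hUo hcle).analyticAt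
      (hUo.mem_nhds hU0)
  · change ∑' n, (0 : ℂ) ^ n • c n = 1
    rw [tsum_eq_single 0 fun n hn ↦ by rw [zero_pow hn, zero_smul]]
    simp [hc, gaugeCoeff_zero]
  · filter_upwards [hUo.mem_nhds hU0, hp.eventually_hasSum] with z hz hBz
    rw [zero_add] at hBz
    have hBz' : B z = ∑' n, z ^ n • b n := by
      rw [← hBz.tsum_eq]
      simp [hb]
    have hderiv := Complex.hasSum_deriv_of_summable_norm hsum hdiff hUo hcle hz
    have h1 := (hderiv.const_smul z)
    have hcs : Summable fun n ↦ ‖z ^ n • c n‖ :=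
      hsum.of_nonneg_of_le (fun _ ↦ norm_nonneg _) fun n ↦ hcle n z hz
    have hbs : Summable fun n ↦ ‖z ^ n • b n‖ :=
      hsum'.of_nonneg_of_le (fun _ ↦ norm_nonneg _) fun n ↦ hble n z hz
    have h2 := (hasSum_sum_range_mul_of_summable_norm hbs hcs).neg.add
      (hcs.of_norm.hasSum.mul_right (B 0))
    rw [← hBz'] at h2
    refine h1.unique ?_
    convert! h2 using 2 with n
    have hd : deriv (fun z : ℂ ↦ z ^ n • c n) z = (n * z ^ (n - 1)) • c n := by
      rw [deriv_smul_const (by fun_prop)]; simp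
    rw [hd]
    have h3 : z • ((n : ℂ) * z ^ (n - 1)) • c n = z ^ n • ((n : ℂ) • c n) := by
      cases n with
      | zero => simp
      | succ n => rw [smul_smul, smul_smul, Nat.add_sub_cancel]; congr 1; ring
    rw [h3, gaugeCoeff_rec (by rw [hb0, hN]), smul_add, smul_neg, Finset.smul_sum, hb0,
      smul_mul_assoc]
    congr 2
    refine Finset.sum_congr rfl fun k hk ↦ ?_
    rw [smul_mul_smul_comm, ← pow_add, Nat.add_sub_cancel' (by simpa [Nat.lt_succ_iff] using hk)]

/-- If the residue `A 0` of the system `z f' = -A f` has eigenvalues `0` and `-1`, that is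
`-A 0` is idempotent, then the meromorphic gauge transformation `1 + A 0 - z A 0`, which multiplies
the `-1`-eigenvectors by `z`, turns the system into one whose residue `B 0` has square zero. -/
lemma exists_shearing {A : ℂ → 𝔸} (hA : AnalyticAt ℂ A 0) (hA0 : A 0 * A 0 = -A 0) :
    ∃ B : ℂ → 𝔸, AnalyticAt ℂ B 0 ∧ B 0 = -A 0 * deriv A 0 * (1 + A 0) ∧
      ∀ z : ℂ, (1 + A 0 - z • A 0) * B z = A z * (1 + A 0 - z • A 0) - z • A 0 := by
  obtain ⟨a, ha⟩ : ∃ a, a = A 0 := ⟨_, rfl⟩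
  rw [← ha] at hA0 ⊢
  have haa : ∀ x : 𝔸, a * (a * x) = -(a * x) := fun x ↦ by rw [← mul_assoc, hA0, neg_mul]
  have hA1 : AnalyticAt ℂ (dslope A 0) 0 := by
    obtain ⟨p, hp⟩ := hA
    exact ⟨_, hp.has_fpower_series_dslope_fslope⟩
  refine ⟨fun z ↦ -(z • ((1 + a) * A z * a)) - a * dslope A 0 z * (1 + a) + a * A z * a - a
    + (1 + a) * A z * (1 + a), by fun_prop, ?_, fun z ↦ ?_⟩
  · simp only [dslope_same, zero_smul, ← ha, hA0, add_mul, mul_add, neg_mul, one_mul, mul_one,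
      mul_assoc]
    abel
  · have hz : z • dslope A 0 z = A z - a := by
      simpa [ha] using sub_smul_dslope A 0 z
    have hz' : z • (a * dslope A 0 z) = a * A z + a := by
      rw [← mul_smul_comm, hz, mul_sub, hA0, sub_neg_eq_add]
    have hz'' : z • (a * (dslope A 0 z * a)) = a * (A z * a) - a := by
      rw [← mul_assoc, ← smul_mul_assoc, hz', add_mul, hA0, mul_assoc, sub_eq_add_neg]
    simp only [add_mul, mul_add, sub_mul, mul_sub, one_mul, mul_one, mul_assoc, haa, mul_neg,
      smul_mul_assoc, mul_smul_comm, smul_add, smul_neg, smul_sub, hz', hz'', hA0]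
    abel

/-- A fundamental solution `Φ` of `z f' = -A f` around a resonant regular singular point with
exponents `0` and `1`, written in the coordinate `w = log z`, and its monodromy. -/
theorem exists_fundamentalSolution [CompleteSpace 𝔸] {A : ℂ → 𝔸} (hA : AnalyticAt ℂ A 0)
    (hA0 : A 0 * A 0 = -A 0) :
    ∃ Φ : ℂ → 𝔸, (∀ᶠ z in 𝓝 0, ∀ w, Complex.exp w = z →
        IsUnit (Φ w) ∧ HasDerivAt Φ (-(A z * Φ w)) w) ∧
      ∀ w, Φ (w + 2 * Real.pi * Complex.I) =
        Φ w * (1 - (2 * Real.pi * Complex.I : ℂ) • (-A 0 * deriv A 0 * (1 + A 0))) := by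
  obtain ⟨B, hB, hB0, hAB⟩ := exists_shearing hA hA0
  rw [← hB0]
  have hN : B 0 * B 0 = 0 := by
    have h : (1 + A 0) * A 0 = 0 := by rw [add_mul, hA0, one_mul, add_neg_cancel]
    calc B 0 * B 0 = -(A 0 * deriv A 0 * ((1 + A 0) * A 0) * (-(deriv A 0 * (1 + A 0)))) := by
          rw [hB0]; simp only [mul_assoc, neg_mul, mul_neg, neg_neg]
      _ = 0 := by rw [h]; simp
  obtain ⟨P, hP, hP0, hPB⟩ := exists_gauge hB hN
  have hPunit : ∀ᶠ z in 𝓝 0, IsUnit (P z) := by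
    have : IsUnit (P 0) := hP0 ▸ isUnit_one
    exact hP.continuousAt.eventually (Units.isOpen.mem_nhds this)
  have hSunit : ∀ z : ℂ, z ≠ 0 → IsUnit (1 + A 0 - z • A 0) := fun z hz ↦ by
    refine ⟨⟨_, 1 + A 0 - z⁻¹ • A 0, ?_, ?_⟩, rfl⟩ <;>
    · simp only [add_mul, mul_add, sub_mul, mul_sub, one_mul, mul_one, smul_mul_assoc,
        mul_smul_comm, hA0, smul_neg, smul_add, smul_sub,
        smul_inv_smul₀ hz, inv_smul_smul₀ hz]
      abel
  have hNunit : ∀ w : ℂ, IsUnit (1 - w • B 0) := fun w ↦ by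
    refine ⟨⟨_, 1 + w • B 0, ?_, ?_⟩, rfl⟩ <;>
      simp [mul_add, add_mul, mul_sub, sub_mul, hN]
  refine ⟨fun w ↦ (1 + A 0 - Complex.exp w • A 0) * (P (Complex.exp w) * (1 - w • B 0)), ?_,
    fun w ↦ ?_⟩
  · filter_upwards [hPunit, hP.eventually_analyticAt, hPB] with z h1 h2 h3 w hw
    have hz : z ≠ 0 := hw ▸ Complex.exp_ne_zero w
    rw [hw]
    refine ⟨(hSunit z hz).mul (h1.mul (hNunit w)), ?_⟩
    have hexp : HasDerivAt Complex.exp z w := hw ▸ Complex.hasDerivAt_exp w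
    have d1 : HasDerivAt (fun w ↦ 1 + A 0 - Complex.exp w • A 0) (-(z • A 0)) w :=
      (hexp.smul_const (A 0)).const_sub _
    have d2 : HasDerivAt (fun w ↦ P (Complex.exp w)) (z • deriv P z) w := by
      rw [← hw] at h2
      have := h2.differentiableAt.hasDerivAt.scomp w hexp
      rwa [hw] at this
    have d3 : HasDerivAt (fun w : ℂ ↦ 1 - w • B 0) (-((1 : ℂ) • B 0)) w :=
      ((hasDerivAt_id w).smul_const (B 0)).const_sub _
    refine (d1.mul (d2.mul d3)).congr_deriv ?_
    simp only [Pi.mul_apply, hw]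
    rw [h3, one_smul]
    have e : A z * (1 + A 0 - z • A 0) = (1 + A 0 - z • A 0) * B z + z • A 0 := by
      rw [hAB]; abel
    rw [← mul_assoc (A z), e]
    simp only [add_mul (-(B z * P z)), mul_sub, mul_one, mul_smul_comm, neg_mul, mul_neg,
      mul_assoc (P z), hN, smul_zero, sub_zero, add_mul ((1 + A 0 - z • A 0) * B z)]
    simp only [mul_add, mul_sub, mul_neg, mul_smul_comm, smul_mul_assoc, mul_assoc, smul_neg]
    abel
  · dsimp only
    have h : 1 - (w + 2 * Real.pi * Complex.I) • B 0 =
        (1 - w • B 0) * (1 - (2 * Real.pi * Complex.I : ℂ) • B 0) := by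
      simp only [mul_sub, sub_mul, mul_one, one_mul, smul_mul_smul_comm, hN, smul_zero, sub_zero,
        add_smul]
      abel
    rw [Complex.exp_periodic w, h, mul_assoc (1 + A 0 - _), mul_assoc (P _)]

/-- The inverse of a fundamental solution solves the adjoint equation. -/
lemma HasDerivAt.ringInverse_of_isUnit [CompleteSpace 𝔸] {Φ : ℂ → 𝔸} {a : 𝔸} {w : ℂ}
    (hu : IsUnit (Φ w)) (h : HasDerivAt Φ (-(a * Φ w)) w) :
    HasDerivAt (fun w ↦ Ring.inverse (Φ w)) (Ring.inverse (Φ w) * a) w := by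
  obtain ⟨u, hu⟩ := hu
  have h1 := hasFDerivAt_ringInverse (𝕜 := ℂ) u
  rw [hu] at h1
  refine (h1.comp_hasDerivAt w h).congr_deriv ?_
  rw [← hu, Ring.inverse_unit, neg_apply, ContinuousLinearMap.mulLeftRight_apply]
  simp [mul_assoc]

end RegularSingular

/-! ### Holomorphic coordinates and one-forms -/

section Coordinates

variable {Y : Type*} [TopologicalSpace Y] [ChartedSpace ℂ Y]

/-- The coordinate vector field `∂/∂z` of the coordinate `z = φ`, at the point `φ.symm z`. -/
def coordVec (φ : OpenPartialHomeomorph Y ℂ) (z : ℂ) : TangentSpace 𝓘(ℂ) (φ.symm z) :=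
  mfderiv 𝓘(ℂ) 𝓘(ℂ) φ.symm z (1 : ℂ)

variable {φ : OpenPartialHomeomorph Y ℂ}

lemma mdifferentiable_of_mem_maximalAtlas (hφ : φ ∈ IsManifold.maximalAtlas 𝓘(ℂ) ω Y) :
    φ.MDifferentiable 𝓘(ℂ) 𝓘(ℂ) :=
  ⟨(contMDiffOn_of_mem_maximalAtlas hφ).mdifferentiableOn (by simp),
    (contMDiffOn_symm_of_mem_maximalAtlas hφ).mdifferentiableOn (by simp)⟩

lemma mvfderiv_coordVec (hφ : φ ∈ IsManifold.maximalAtlas 𝓘(ℂ) ω Y) {z : ℂ} (hz : z ∈ φ.target) :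
    mvfderiv 𝓘(ℂ) φ (φ.symm z) (coordVec φ z) = 1 :=
  congr($((mdifferentiable_of_mem_maximalAtlas hφ).comp_symm_deriv hz) (1 : ℂ))

lemma eq_smul_coordVec (hφ : φ ∈ IsManifold.maximalAtlas 𝓘(ℂ) ω Y) {z : ℂ} (hz : z ∈ φ.target)
    (t : TangentSpace 𝓘(ℂ) (φ.symm z)) :
    t = mvfderiv 𝓘(ℂ) φ (φ.symm z) t • coordVec φ z := by
  have h := (mdifferentiable_of_mem_maximalAtlas hφ).symm_comp_deriv (φ.map_target hz)
  rw [φ.right_inv hz] at h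
  have h1 := congr($h t)
  refine h1.symm.trans ?_
  change mfderiv 𝓘(ℂ) 𝓘(ℂ) φ.symm z (mfderiv 𝓘(ℂ) 𝓘(ℂ) φ (φ.symm z) t) = _
  have key : ∀ c : ℂ, mfderiv 𝓘(ℂ) 𝓘(ℂ) φ.symm z c =
      c • mfderiv 𝓘(ℂ) 𝓘(ℂ) φ.symm z (1 : ℂ) := fun c ↦ by
    refine Eq.trans ?_ (map_smul (mfderiv 𝓘(ℂ) 𝓘(ℂ) φ.symm z) c (1 : ℂ))
    exact congrArg (mfderiv 𝓘(ℂ) 𝓘(ℂ) φ.symm z) (mul_one (M := ℂ) c).symm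
  exact key _

/-- A one-form is the multiple of `dz` by its value on `∂/∂z`. -/
lemma eq_smulRight_coordVec {W : Type*} [AddCommGroup W] [Module ℂ W] [TopologicalSpace W]
    [ContinuousSMul ℂ W]
    (hφ : φ ∈ IsManifold.maximalAtlas 𝓘(ℂ) ω Y) {z : ℂ} (hz : z ∈ φ.target)
    (η : TangentSpace 𝓘(ℂ) (φ.symm z) →L[ℂ] W) :
    η = (mvfderiv 𝓘(ℂ) φ (φ.symm z)).smulRight (η (coordVec φ z)) := by
  refine ContinuousLinearMap.ext fun t ↦ ?_
  conv_lhs => rw [eq_smul_coordVec hφ hz t]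
  simp

lemma mvfderiv_apply_coordVec {V : Type*} [NormedAddCommGroup V] [NormedSpace ℂ V]
    (hφ : φ ∈ IsManifold.maximalAtlas 𝓘(ℂ) ω Y) {z : ℂ} (hz : z ∈ φ.target) {f : Y → V}
    (hf : MDifferentiableAt 𝓘(ℂ) 𝓘(ℂ, V) f (φ.symm z)) :
    mvfderiv 𝓘(ℂ) f (φ.symm z) (coordVec φ z) = deriv (f ∘ φ.symm) z := by
  have h := mfderiv_comp z hf
    ((mdifferentiable_of_mem_maximalAtlas hφ).mdifferentiableAt_symm hz)
  rw [mfderiv_eq_fderiv] at h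
  exact congr($h (1 : ℂ)).symm

/-- Every point of a Riemann surface is the origin of some holomorphic coordinate. -/
lemma exists_isCoordAt [IsManifold 𝓘(ℂ) ω Y] (y : Y) : ∃ φ : OpenPartialHomeomorph Y ℂ, IsCoordAt φ y := by
  refine ⟨(chartAt ℂ y).transHomeomorph (Homeomorph.subRight (chartAt ℂ y y)), ?_,
    mem_chart_source ℂ y, by simp⟩
  have h := IsManifold.chart_mem_maximalAtlas (I := 𝓘(ℂ)) (n := ω) y
  refine OpenPartialHomeomorph.mem_maximalAtlas_of_contMDiffOn (M := Y) (I := 𝓘(ℂ)) (n := ω) _ ?_ ?_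
  · have h1 : ContMDiff 𝓘(ℂ) 𝓘(ℂ) ω (fun z : ℂ ↦ z - chartAt ℂ y y) :=
      (contDiff_id.sub contDiff_const).contMDiff
    exact h1.comp_contMDiffOn (contMDiffOn_of_mem_maximalAtlas h)
  · have h1 : ContMDiff 𝓘(ℂ) 𝓘(ℂ) ω (fun z : ℂ ↦ z + chartAt ℂ y y) :=
      (contDiff_id.add contDiff_const).contMDiff
    exact (contMDiffOn_symm_of_mem_maximalAtlas h).comp h1.contMDiffOn fun z hz ↦ hz

lemma IsCoordAt.zero_mem_target {y : Y} (hφ : IsCoordAt φ y) : 0 ∈ φ.target :=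
  hφ.map_eq_zero ▸ φ.map_source hφ.mem_source

lemma IsCoordAt.symm_zero {y : Y} (hφ : IsCoordAt φ y) : φ.symm 0 = y := by
  rw [← hφ.map_eq_zero, φ.left_inv hφ.mem_source]

lemma IsCoordAt.tendsto_symm {y : Y} (hφ : IsCoordAt φ y) : Tendsto φ.symm (𝓝 0) (𝓝 y) := by
  have := φ.continuousAt_symm hφ.zero_mem_target
  rwa [ContinuousAt, hφ.symm_zero] at this

lemma IsCoordAt.symm_ne {y : Y} (hφ : IsCoordAt φ y) {z : ℂ} (hz : z ∈ φ.target) (h0 : z ≠ 0) :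
    φ.symm z ≠ y := fun h ↦ h0 <| by rw [← φ.right_inv hz, h, hφ.map_eq_zero]

lemma IsCoordAt.exists_mvfderiv_eq_one (hφ : IsCoordAt φ y) :
    ∃ v : TangentSpace 𝓘(ℂ) y, mvfderiv 𝓘(ℂ) φ y v = 1 := by
  obtain rfl := hφ.symm_zero
  exact ⟨_, mvfderiv_coordVec hφ.mem_atlas hφ.zero_mem_target⟩

lemma toHom_tmul {W : Type*} [AddCommGroup W] [Module ℂ W] (y : Y) (w : W) (ξ : Cotangent y)
    (v : TangentSpace 𝓘(ℂ) y) : toHom y (w ⊗ₜ ξ) v = ξ v • w := rfl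

lemma toHom_injective {W : Type*} [AddCommGroup W] [Module ℂ W] (y : Y) :
    Function.Injective (toHom (W := W) y) := by
  have : FiniteDimensional ℂ (TangentSpace 𝓘(ℂ) y) := inferInstanceAs (FiniteDimensional ℂ ℂ)
  exact (dualTensorHomEquiv ℂ (TangentSpace 𝓘(ℂ) y) W).injective.comp
    (TensorProduct.comm ℂ W (Cotangent y)).injective

end Coordinates

section Forms

variable {Y : Type*} [TopologicalSpace Y] [ChartedSpace ℂ Y]
  {F : Type*} [NormedAddCommGroup F]
  {E : Y → Type*} [TopologicalSpace (TotalSpace F E)]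
  {φ : OpenPartialHomeomorph Y ℂ} {y : Y}

/-- The section `s` of `E`, read in the coordinate `φ` and the trivialization `e`. -/
def localRep (e : Trivialization F (TotalSpace.proj : TotalSpace F E → Y))
    (φ : OpenPartialHomeomorph Y ℂ) (s : Π x, E x) (z : ℂ) : F :=
  (e ⟨φ.symm z, s (φ.symm z)⟩).2

lemma localRep_zero (e : Trivialization F (TotalSpace.proj : TotalSpace F E → Y))
    (hφ : IsCoordAt φ y) (s : Π x, E x) : localRep e φ s 0 = (e ⟨y, s y⟩).2 := by
  rw [localRep, hφ.symm_zero]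

variable [NormedSpace ℂ F] [∀ x, AddCommGroup (E x)] [∀ x, Module ℂ (E x)]
  [∀ x, TopologicalSpace (E x)] [FiberBundle F E] [VectorBundle ℂ F E]
  [ContMDiffVectorBundle ω F E 𝓘(ℂ)]

lemma analyticAt_localRep (hφ : φ ∈ IsManifold.maximalAtlas 𝓘(ℂ) ω Y)
    (e : Trivialization F (TotalSpace.proj : TotalSpace F E → Y)) [MemTrivializationAtlas e]
    {s : Π x, E x} {z : ℂ} (hz : z ∈ φ.target) (hze : φ.symm z ∈ e.baseSet)
    (hs : ContMDiffAt 𝓘(ℂ) (𝓘(ℂ).prod 𝓘(ℂ, F)) ω (fun x ↦ TotalSpace.mk' F x (s x)) (φ.symm z)) :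
    AnalyticAt ℂ (localRep e φ s) z := by
  have h := (e.contMDiffAt_section_iff hze).1 hs
  exact (contMDiffAt_iff_contDiffAt.1
    (h.comp z (contMDiffAt_symm_of_mem_maximalAtlas hφ hz))).analyticAt

lemma contMDiffAt_symm_section [CompleteSpace F] (hφ : φ ∈ IsManifold.maximalAtlas 𝓘(ℂ) ω Y)
    (e : Trivialization F (TotalSpace.proj : TotalSpace F E → Y)) [MemTrivializationAtlas e]
    {g : ℂ → F} {x : Y} (hx : x ∈ φ.source) (hxe : x ∈ e.baseSet) (hg : AnalyticAt ℂ g (φ x)) :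
    ContMDiffAt 𝓘(ℂ) (𝓘(ℂ).prod 𝓘(ℂ, F)) ω
      (fun x ↦ TotalSpace.mk' F x (e.symm x (g (φ x)))) x := by
  rw [e.contMDiffAt_section_iff hxe]
  have h : ContMDiffAt 𝓘(ℂ) 𝓘(ℂ, F) ω (fun x ↦ g (φ x)) x :=
    hg.contDiffAt.contMDiffAt.comp x (contMDiffAt_of_mem_maximalAtlas hφ hx)
  refine h.congr_of_eventuallyEq ?_
  filter_upwards [e.open_baseSet.mem_nhds hxe] with x' hx'
  rw [e.apply_mk_symm hx']

lemma holSection_symm_const (e : Trivialization F (TotalSpace.proj : TotalSpace F E → Y))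
    [MemTrivializationAtlas e] (v : F) : HolSection F e.baseSet (fun x ↦ (e.symm x v : E x)) := by
  rw [HolSection, e.contMDiffOn_section_baseSet_iff]
  exact contMDiffOn_const.congr fun x hx ↦ by rw [e.apply_mk_symm hx]

variable [IsManifold 𝓘(ℂ) ω Y] [∀ x, IsTopologicalAddGroup (E x)] [∀ x, ContinuousSMul ℂ (E x)]

/-- A holomorphic one-form evaluated on `∂/∂z` is holomorphic. -/
lemma HolForm.analyticAt {U : Set Y} {ζ : Π x, TangentSpace 𝓘(ℂ) x →L[ℂ] E x}
    (hζ : HolForm F U ζ) (hφ : φ ∈ IsManifold.maximalAtlas 𝓘(ℂ) ω Y)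
    (e : Trivialization F (TotalSpace.proj : TotalSpace F E → Y)) [MemTrivializationAtlas e]
    {z : ℂ} (hz : z ∈ φ.target) (hze : φ.symm z ∈ e.baseSet) (hU : U ∈ 𝓝 (φ.symm z)) :
    AnalyticAt ℂ (fun z ↦ (e ⟨φ.symm z, ζ (φ.symm z) (coordVec φ z)⟩).2) z := by
  have hφz := contMDiffAt_symm_of_mem_maximalAtlas hφ hz
  have h1 : ContMDiffAt 𝓘(ℂ) (𝓘(ℂ).prod 𝓘(ℂ, ℂ →L[ℂ] F)) ω (fun z ↦
      TotalSpace.mk' (E := fun x ↦ TangentSpace 𝓘(ℂ) x →L[ℂ] E x) (ℂ →L[ℂ] F)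
        (φ.symm z) (ζ (φ.symm z))) z :=
    (ContMDiffOn.contMDiffAt hζ hU).comp z hφz
  have h2 : ContMDiffAt 𝓘(ℂ) (𝓘(ℂ).prod 𝓘(ℂ)) ω (fun z ↦
      TotalSpace.mk' (E := fun x ↦ TangentSpace 𝓘(ℂ) x) ℂ (φ.symm z) (coordVec φ z)) z := by
    have h3 := (contMDiffOn_symm_of_mem_maximalAtlas hφ).contMDiffOn_tangentMapWithin (m := ω)
      (by simp) φ.open_target.uniqueMDiffOn
    have h4 : ContMDiff 𝓘(ℂ) 𝓘(ℂ).tangent ω (fun z : ℂ ↦ (⟨z, (1 : ℂ)⟩ : TangentBundle 𝓘(ℂ) ℂ)) :=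
      contMDiff_vectorSpace_iff_contDiff.2 contDiff_const
    have h5 := (h3.contMDiffAt ((φ.open_target.preimage
      (FiberBundle.continuous_proj ℂ (TangentSpace 𝓘(ℂ)))).mem_nhds hz)).comp z (h4 z)
    refine h5.congr_of_eventuallyEq ?_
    filter_upwards [φ.open_target.mem_nhds hz] with z' hz'
    simp only [Function.comp, tangentMapWithin, coordVec]
    rw [mfderivWithin_of_isOpen φ.open_target hz']
  have h6 := h1.clm_bundle_apply h2
  exact (contMDiffAt_iff_contDiffAt.1 ((e.contMDiffAt_iff (e.mem_source.2 hze)).1 h6).2).analyticAt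

/-- The form `g(z) dz` is holomorphic where `g` is. -/
lemma holForm_smulRight [CompleteSpace F] (hφ : φ ∈ IsManifold.maximalAtlas 𝓘(ℂ) ω Y)
    (e : Trivialization F (TotalSpace.proj : TotalSpace F E → Y)) [MemTrivializationAtlas e]
    {g : ℂ → F} {U : Set Y} (hU : U ⊆ φ.source) (hUe : U ⊆ e.baseSet)
    (hg : ∀ x ∈ U, AnalyticAt ℂ g (φ x)) :
    HolForm F U fun x ↦ (mvfderiv 𝓘(ℂ) φ x).smulRight (e.symm x (g (φ x)) : E x) := by
  intro x₀ hx₀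
  refine ContMDiffAt.contMDiffWithinAt ?_
  rw [contMDiffAt_hom_bundle]
  refine ⟨contMDiffAt_id, ?_⟩
  have hφx := contMDiffAt_of_mem_maximalAtlas hφ (hU hx₀)
  have h1 := hφx.mfderiv_const (m := ω) (by simp)
  have h2 := contMDiffAt_symm_section hφ e (hU hx₀) (hUe hx₀) (hg x₀ hx₀)
  rw [contMDiffAt_section] at h2
  have h3 := ((contMDiffAt_const (c := ContinuousLinearMap.smulRightL ℂ ℂ F)).clm_apply
    h1).clm_apply h2
  refine h3.congr_of_eventuallyEq ?_
  filter_upwards [(trivializationAt F E x₀).open_baseSet.mem_nhds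
    (FiberBundle.mem_baseSet_trivializationAt' x₀)] with x hx
  ext
  simp [inTangentCoordinates, ContinuousLinearMap.inCoordinates, mvfderiv,
    Trivialization.coe_linearMapAt_of_mem _ hx]
  rfl

end Forms

/-! ### The connection matrix -/

section ConnectionMatrix

variable {Y : Type*} [TopologicalSpace Y] [ChartedSpace ℂ Y]
  {F : Type*} [NormedAddCommGroup F] [NormedSpace ℂ F]
  {E : Y → Type*} [TopologicalSpace (TotalSpace F E)]
  [∀ x, AddCommGroup (E x)] [∀ x, Module ℂ (E x)] [∀ x, TopologicalSpace (E x)]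
  [∀ x, IsTopologicalAddGroup (E x)] [∀ x, ContinuousSMul ℂ (E x)]
  [FiberBundle F E] [VectorBundle ℂ F E]

lemma cov_sum {cov : (Π x, E x) → Π x, TangentSpace 𝓘(ℂ) x →L[ℂ] E x} {u : Set Y}
    (hcov : IsCovariantDerivativeOn F cov u) {ι : Type*} (t : Finset ι) {σ : ι → Π x, E x} {x : Y}
    (hx : x ∈ u) (hσ : ∀ i, MDifferentiableAt 𝓘(ℂ) (𝓘(ℂ).prod 𝓘(ℂ, F))
      (fun x ↦ TotalSpace.mk' F x (σ i x)) x) :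
    cov (∑ i ∈ t, σ i) x = ∑ i ∈ t, cov (σ i) x := by
  classical
  induction t using Finset.induction_on with
  | empty => simpa using hcov.zero hx
  | insert i t hi ih =>
    rw [Finset.sum_insert hi, Finset.sum_insert hi, hcov.add (hσ i) ?_ hx, ih]
    convert! MDifferentiableAt.sum_section (s := t) (fun i _ ↦ hσ i) using 3
    simp

variable [IsManifold 𝓘(ℂ) ω Y] {S : Finset Y} {φ : OpenPartialHomeomorph Y ℂ} {y : Y}

/-- `A dz / z` is the connection matrix of `D` at the point `φ.symm z ∉ S`, with respect to the
coordinate `z = φ` and the trivialization `e`: the connection acts on sections differentiable at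
this point as `f ↦ (f' + z⁻¹ A f) dz`. -/
structure LogConnection.IsConnectionMatrixAt (D : LogConnection F E S)
    (e : Trivialization F (TotalSpace.proj : TotalSpace F E → Y)) [MemTrivializationAtlas e]
    (φ : OpenPartialHomeomorph Y ℂ) (A : ℂ → F →L[ℂ] F) (z : ℂ) : Prop where
  mem_target : z ∈ φ.target
  mem_baseSet : φ.symm z ∈ e.baseSet
  notMem : φ.symm z ∉ S
  cov_eq : ∀ s : Π x, E x, MDifferentiableAt 𝓘(ℂ) (𝓘(ℂ).prod 𝓘(ℂ, F))
      (fun x ↦ TotalSpace.mk' F x (s x)) (φ.symm z) →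
    D.D s (φ.symm z) = (mvfderiv 𝓘(ℂ) φ (φ.symm z)).smulRight (e.symm (φ.symm z)
      (deriv (localRep e φ s) z + z⁻¹ • A z (localRep e φ s z)) : E (φ.symm z))

/-- `A dz / z` is the connection matrix of `D` on a punctured neighbourhood of the origin of the
coordinate `z = φ`, with respect to the trivialization `e`. -/
def LogConnection.HasConnectionMatrix (D : LogConnection F E S)
    (e : Trivialization F (TotalSpace.proj : TotalSpace F E → Y)) [MemTrivializationAtlas e]
    (φ : OpenPartialHomeomorph Y ℂ) (A : ℂ → F →L[ℂ] F) : Prop :=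
  ∀ᶠ z in 𝓝[≠] 0, D.IsConnectionMatrixAt e φ A z

variable [ContMDiffVectorBundle ω F E 𝓘(ℂ)] [FiniteDimensional ℂ F] [T2Space Y]

/-- A logarithmic connection has a connection matrix `A dz / z` with `A` holomorphic, and `A 0` is
the residue. -/
theorem LogConnection.exists_hasConnectionMatrix (D : LogConnection F E S)
    {R : E y →ₗ[ℂ] E y} (hR : D.IsResidue y R) (hφ : IsCoordAt φ y)
    (e : Trivialization F (TotalSpace.proj : TotalSpace F E → Y)) [MemTrivializationAtlas e]
    (hy : y ∈ e.baseSet) :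
    ∃ A : ℂ → F →L[ℂ] F, AnalyticAt ℂ A 0 ∧ (∀ v, (e.symm y (A 0 v) : E y) = R (e.symm y v)) ∧
      D.HasConnectionMatrix e φ A := by
  obtain rfl := hφ.symm_zero
  have h0 := hφ.zero_mem_target
  set b := Module.finBasis ℂ F
  set c : Fin (Module.finrank ℂ F) → F →L[ℂ] ℂ := fun i ↦ LinearMap.toContinuousLinearMap (b.coord i)
    with hc
  have hcb : ∀ v : F, ∑ i, c i v • b i = v := fun v ↦ b.sum_repr v
  set σ : Fin (Module.finrank ℂ F) → Π x, E x := fun i x ↦ e.symm x (b i) with hσ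
  have hσhol : ∀ i, HolSection F e.baseSet (σ i) := fun i ↦
    holSection_symm_const e (b i)
  choose U hUo hU0 ζ hζ hζσ hζ0 using fun i ↦ hR e.baseSet (σ i) e.open_baseSet hy (hσhol i) φ hφ
  set a : Fin (Module.finrank ℂ F) → ℂ → F :=
    fun i z ↦ (e ⟨φ.symm z, ζ i (φ.symm z) (coordVec φ z)⟩).2 with ha
  have haan : ∀ i, AnalyticAt ℂ (a i) 0 := fun i ↦
    (hζ i).analyticAt hφ.mem_atlas e h0 hy ((hUo i).mem_nhds (hU0 i))
  refine ⟨fun z ↦ ∑ i, (c i).smulRight (a i z), ?_, fun v ↦ ?_, ?_⟩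
  · exact Finset.analyticAt_fun_sum _ fun i _ ↦
      ((ContinuousLinearMap.smulRightL ℂ F F (c i)).analyticAt _).comp (haan i)
  · have ha0 : ∀ i, (e.symm _ (a i 0) : E (φ.symm 0)) = R (σ i (φ.symm 0)) := fun i ↦ by
      rw [ha]
      dsimp only
      rw [e.symm_apply_apply_mk hy, hζ0, ContinuousLinearMap.smulRight_apply,
        mvfderiv_coordVec hφ.mem_atlas h0, one_smul]
    simp only [← e.symmL_apply (R := ℂ) hy, hσ] at ha0 ⊢
    conv_rhs => rw [← hcb v]
    simp [map_sum, ha0]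
  · have e1 : ∀ᶠ z in 𝓝 (0 : ℂ), z ∈ φ.target := φ.open_target.mem_nhds h0
    have e2 : ∀ᶠ z in 𝓝 (0 : ℂ), φ.symm z ∈ e.baseSet :=
      hφ.tendsto_symm (e.open_baseSet.mem_nhds hy)
    have e3 : ∀ᶠ z in 𝓝 (0 : ℂ), ∀ i, φ.symm z ∈ U i :=
      eventually_all.2 fun i ↦ hφ.tendsto_symm ((hUo i).mem_nhds (hU0 i))
    have e4 : ∀ᶠ z in 𝓝 (0 : ℂ), φ.symm z ∉ (S : Set Y) \ {φ.symm 0} :=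
      hφ.tendsto_symm ((S.finite_toSet.subset Set.sdiff_subset).isClosed.isOpen_compl.mem_nhds
        (by simp))
    filter_upwards [nhdsWithin_le_nhds e1, nhdsWithin_le_nhds e2, nhdsWithin_le_nhds e3,
      nhdsWithin_le_nhds e4, self_mem_nhdsWithin] with z hz hze hzU hzS hz0
    have hzy : φ.symm z ≠ φ.symm 0 := hφ.symm_ne hz hz0
    have hzS' : φ.symm z ∉ (S : Set Y) := fun h ↦ hzS ⟨h, hzy⟩
    refine ⟨hz, hze, hzS', fun s hs ↦ ?_⟩
    rw [eq_smulRight_coordVec hφ.mem_atlas hz (D.D s (φ.symm z))]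
    congr 1
    have hcompl : (S : Set Y)ᶜ ∈ 𝓝 (φ.symm z) :=
      S.finite_toSet.isClosed.isOpen_compl.mem_nhds hzS'
    -- The components of `s` with respect to the frame `σ`.
    set f : Fin (Module.finrank ℂ F) → Y → ℂ := fun i x ↦ c i (e ⟨x, s x⟩).2 with hf
    have hes : MDifferentiableAt 𝓘(ℂ) 𝓘(ℂ, F) (fun x ↦ (e ⟨x, s x⟩).2) (φ.symm z) :=
      (e.mdifferentiableAt_section_iff 𝓘(ℂ) s hze).1 hs
    have hfd : ∀ i, MDifferentiableAt 𝓘(ℂ) 𝓘(ℂ) (f i) (φ.symm z) := fun i ↦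
      (c i).differentiableAt.mdifferentiableAt.comp _ hes
    have hσd : ∀ i, MDifferentiableAt 𝓘(ℂ) (𝓘(ℂ).prod 𝓘(ℂ, F))
        (fun x ↦ TotalSpace.mk' F x (σ i x)) (φ.symm z) := fun i ↦
      ((hσhol i).contMDiffAt (e.open_baseSet.mem_nhds hze)).mdifferentiableAt (by simp)
    have hfσ : ∀ i, MDifferentiableAt 𝓘(ℂ) (𝓘(ℂ).prod 𝓘(ℂ, F))
        (fun x ↦ TotalSpace.mk' F x ((f i • σ i) x)) (φ.symm z) := fun i ↦
      (hfd i).smul_section (hσd i)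
    have hsum : D.D s (φ.symm z) = D.D (∑ i, f i • σ i) (φ.symm z) := by
      refine D.isCov.congr_of_eventuallyEq hs ?_ hcompl ?_
      · convert! MDifferentiableAt.sum_section (s := Finset.univ) (fun i _ ↦ hfσ i) using 3
        simp
      · filter_upwards [e.open_baseSet.mem_nhds hze] with x hx
        rw [Finset.sum_apply]
        have : (s x : E x) = e.symmL ℂ x (∑ i, f i x • b i) := by
          rw [hcb, e.symmL_apply hx, e.symm_apply_apply_mk hx]
        rw [this, map_sum]
        refine Finset.sum_congr rfl fun i _ ↦ ?_
        rw [map_smul, e.symmL_apply hx]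
        rfl
    rw [hsum, cov_sum D.isCov _ hzS' hfσ]
    have hterm : ∀ i, D.D (f i • σ i) (φ.symm z) (coordVec φ z) =
        e.symmL ℂ (φ.symm z) (c i (deriv (localRep e φ s) z) • b i +
          z⁻¹ • (c i (localRep e φ s z) • a i z)) := fun i ↦ by
      have h1 : D.D (σ i) (φ.symm z) (coordVec φ z) = z⁻¹ • e.symmL ℂ (φ.symm z) (a i z) := by
        rw [e.symmL_apply hze, ha]
        dsimp only
        rw [e.symm_apply_apply_mk hze, hζσ i _ (hzU i) hzy]
        dsimp only
        rw [φ.right_inv hz, smul_apply, inv_smul_smul₀ hz0]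
      have h2 : deriv (f i ∘ φ.symm) z = c i (deriv (localRep e φ s) z) := by
        have h3 : DifferentiableAt ℂ (localRep e φ s) z :=
          (hes.comp z ((mdifferentiable_of_mem_maximalAtlas hφ.mem_atlas).mdifferentiableAt_symm
            hz)).differentiableAt
        exact ((c i).hasFDerivAt.comp_hasDerivAt z h3.hasDerivAt).deriv
      rw [D.isCov.leibniz (hσd i) (hfd i) hzS']
      simp only [add_apply, smul_apply,
        ContinuousLinearMap.smulRight_apply]
      rw [h1, mvfderiv_apply_coordVec hφ.mem_atlas hz (hfd i), h2, map_add, map_smul, map_smul,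
        map_smul, e.symmL_apply hze (b i), add_comm, smul_comm]
      rfl
    rw [sum_apply, Finset.sum_congr rfl fun i _ ↦ hterm i, ← map_sum,
      Finset.sum_add_distrib, hcb, ← Finset.smul_sum, e.symmL_apply hze]
    simp

end ConnectionMatrix

/-! ### The induced homomorphism -/

section InducedHom

variable {Y : Type*} [TopologicalSpace Y] [ChartedSpace ℂ Y] [IsManifold 𝓘(ℂ) ω Y]
  {F : Type*} [NormedAddCommGroup F] [NormedSpace ℂ F]
  {E : Y → Type*} [TopologicalSpace (TotalSpace F E)]
  [∀ x, AddCommGroup (E x)] [∀ x, Module ℂ (E x)] [∀ x, TopologicalSpace (E x)]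
  [∀ x, IsTopologicalAddGroup (E x)] [∀ x, ContinuousSMul ℂ (E x)]
  [FiberBundle F E] [VectorBundle ℂ F E] [ContMDiffVectorBundle ω F E 𝓘(ℂ)]
  {S : Finset Y} {φ : OpenPartialHomeomorph Y ℂ} {y : Y}

/-- The value at `y` of the holomorphic extension of a one-form is unique, as `y` is not
isolated. -/
lemma ExtendsAt.unique {η : Π x, TangentSpace 𝓘(ℂ) x →L[ℂ] E x}
    {θ θ' : TangentSpace 𝓘(ℂ) y →L[ℂ] E y} (h : ExtendsAt F η y θ) (h' : ExtendsAt F η y θ') :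
    θ = θ' := by
  obtain ⟨φ, hφ⟩ := exists_isCoordAt y
  obtain rfl := hφ.symm_zero
  obtain ⟨U, hU, hyU, ζ, hζ, hζη, rfl⟩ := h
  obtain ⟨U', hU', hyU', ζ', hζ', hζη', rfl⟩ := h'
  have h0 := hφ.zero_mem_target
  set e := trivializationAt F E (φ.symm 0)
  have hye : φ.symm 0 ∈ e.baseSet := FiberBundle.mem_baseSet_trivializationAt' _
  have a := hζ.analyticAt hφ.mem_atlas e h0 hye (hU.mem_nhds hyU)
  have a' := hζ'.analyticAt hφ.mem_atlas e h0 hye (hU'.mem_nhds hyU')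
  have key := (a.continuousAt.eventuallyEq_nhds_iff_eventuallyEq_nhdsNE a'.continuousAt).1 (by
    filter_upwards [nhdsWithin_le_nhds (hφ.tendsto_symm (hU.mem_nhds hyU)),
      nhdsWithin_le_nhds (hφ.tendsto_symm (hU'.mem_nhds hyU')),
      nhdsWithin_le_nhds (φ.open_target.mem_nhds h0), self_mem_nhdsWithin] with z h1 h2 h3 h4
    have hz := hφ.symm_ne h3 h4
    rw [hζη _ h1 hz, hζη' _ h2 hz])
  have h1 := congrArg (e.symm (φ.symm 0)) key.eq_of_nhds
  rw [e.symm_apply_apply_mk hye, e.symm_apply_apply_mk hye] at h1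
  rw [eq_smulRight_coordVec hφ.mem_atlas h0 (ζ _), eq_smulRight_coordVec hφ.mem_atlas h0 (ζ' _), h1]

/-- The homomorphism obtained from `D` is unique, because `ℓ₀ ∩ ℓ₁ = 0`. -/
lemma LogConnection.InducesHom.unique {D : LogConnection F E S} {ℓ₀ ℓ₁ : Submodule ℂ (E y)}
    (hℓ : Disjoint ℓ₀ ℓ₁) {ρ ρ' : ℓ₀ →ₗ[ℂ] ℓ₁ ⊗[ℂ] Cotangent y}
    (h : D.InducesHom y ℓ₀ ℓ₁ ρ) (h' : D.InducesHom y ℓ₀ ℓ₁ ρ') : ρ = ρ' := by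
  set e := trivializationAt F E y
  have hy : y ∈ e.baseSet := FiberBundle.mem_baseSet_trivializationAt' _
  refine LinearMap.ext fun α ↦ toHom_injective y <| LinearMap.ext fun v ↦ Subtype.ext ?_
  have hs := holSection_symm_const e (e ⟨y, α⟩).2
  have hsy : (e.symm y (e ⟨y, (α : E y)⟩).2 : E y) = α := e.symm_apply_apply_mk hy _
  obtain ⟨θ, hθ, hθv⟩ := h α _ _ e.open_baseSet hy hs hsy
  obtain ⟨θ', hθ', hθv'⟩ := h' α _ _ e.open_baseSet hy hs hsy
  obtain rfl := hθ.unique hθ'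
  rw [← sub_eq_zero]
  refine Submodule.disjoint_def.1 hℓ _ ?_ (sub_mem (Subtype.prop _) (Subtype.prop _))
  convert sub_mem (hθv' v) (hθv v) using 1
  abel

variable [FiniteDimensional ℂ F]

/-- The value at `y` of `D s`, for a section `s` with `s y` in the kernel of the residue. -/
lemma LogConnection.HasConnectionMatrix.extendsAt {D : LogConnection F E S}
    {e : Trivialization F (TotalSpace.proj : TotalSpace F E → Y)} [MemTrivializationAtlas e]
    {A : ℂ → F →L[ℂ] F} (h : D.HasConnectionMatrix e φ A) (hA : AnalyticAt ℂ A 0)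
    (hφ : IsCoordAt φ y) (hy : y ∈ e.baseSet) {U : Set Y} {s : Π x, E x} (hU : IsOpen U)
    (hyU : y ∈ U) (hs : HolSection F U s) (hs0 : A 0 (e ⟨y, s y⟩).2 = 0) :
    ExtendsAt F (D.D s) y ((mvfderiv 𝓘(ℂ) φ y).smulRight (e.symm y (deriv (localRep e φ s) 0 +
      (deriv A 0 (e ⟨y, s y⟩).2 + A 0 (deriv (localRep e φ s) 0))) : E y)) := by
  have := FiniteDimensional.complete ℂ F
  have h0 := hφ.zero_mem_target
  set f := localRep e φ s with hf
  have hf0 : f 0 = (e ⟨y, s y⟩).2 := localRep_zero e hφ s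
  have hfan : AnalyticAt ℂ f 0 := by
    have h1 : φ.symm 0 ∈ e.baseSet := hφ.symm_zero.symm ▸ hy
    have h2 : φ.symm 0 ∈ U := hφ.symm_zero.symm ▸ hyU
    exact analyticAt_localRep hφ.mem_atlas e h0 h1 (hs.contMDiffAt (hU.mem_nhds h2))
  have hAf : AnalyticAt ℂ (fun z ↦ A z (f z)) 0 := (hA.contDiffAt.clm_apply hfan.contDiffAt (n := ω)).analyticAt
  have hAf0 : A 0 (f 0) = 0 := by rw [hf0, hs0]
  have hd : deriv (fun z ↦ A z (f z)) 0 = deriv A 0 (f 0) + A 0 (deriv f 0) :=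
    (hA.differentiableAt.hasDerivAt.clm_apply hfan.differentiableAt.hasDerivAt).deriv
  have hslope : AnalyticAt ℂ (dslope (fun z ↦ A z (f z)) 0) 0 := by
    obtain ⟨p, hp⟩ := hAf
    exact ⟨_, hp.has_fpower_series_dslope_fslope⟩
  have hgan : AnalyticAt ℂ (fun z ↦ deriv f z + dslope (fun z ↦ A z (f z)) 0 z) 0 :=
    hfan.deriv.add hslope
  obtain ⟨V, hV, hVo, hV0⟩ := eventually_nhds_iff.1
    ((eventually_nhdsWithin_iff.1 h).and hgan.eventually_analyticAt)
  refine ⟨U ∩ e.baseSet ∩ (φ.source ∩ φ ⁻¹' V),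
    (hU.inter e.open_baseSet).inter (φ.isOpen_inter_preimage hVo),
    ⟨⟨hyU, hy⟩, hφ.mem_source, by rwa [Set.mem_preimage, hφ.map_eq_zero]⟩, _,
    holForm_smulRight hφ.mem_atlas e (fun x hx ↦ hx.2.1) (fun x hx ↦ hx.1.2)
      (fun x hx ↦ (hV _ hx.2.2).2), ?_, ?_⟩
  · rintro x ⟨⟨hxU, -⟩, hxφ, hxV⟩ hxy
    obtain ⟨z, hz, rfl⟩ : ∃ z ∈ φ.target, φ.symm z = x := ⟨φ x, φ.map_source hxφ, φ.left_inv hxφ⟩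
    rw [Set.mem_preimage, φ.right_inv hz] at hxV
    have hz0 : z ≠ 0 := fun h ↦ hxy (h ▸ hφ.symm_zero)
    rw [((hV z hxV).1 hz0).cov_eq s
      ((ContMDiffOn.contMDiffAt hs (hU.mem_nhds hxU)).mdifferentiableAt (by simp)),
      φ.right_inv hz, dslope_of_ne _ hz0, slope_def_module, hAf0]
    simp [hf]
  · rw [hφ.map_eq_zero, dslope_same, hd, hf0]

/-- The homomorphism obtained from `D`, in terms of the connection matrix. -/
theorem LogConnection.HasConnectionMatrix.exists_inducesHom {D : LogConnection F E S}
    {e : Trivialization F (TotalSpace.proj : TotalSpace F E → Y)} [MemTrivializationAtlas e]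
    {A : ℂ → F →L[ℂ] F} (h : D.HasConnectionMatrix e φ A) (hA : AnalyticAt ℂ A 0)
    (hφ : IsCoordAt φ y) (hy : y ∈ e.baseSet) {R : Module.End ℂ (E y)}
    (hAR : ∀ v, (e.symm y (A 0 v) : E y) = R (e.symm y v)) (hR : ∀ v, R (R v) = -R v) :
    ∃ ρ : R.eigenspace 0 →ₗ[ℂ] R.eigenspace (-1) ⊗[ℂ] Cotangent y,
      D.InducesHom y _ _ ρ ∧ (ρ = 0 ↔ -A 0 * deriv A 0 * (1 + A 0) = 0) := by
  set L := e.continuousLinearEquivAt ℂ y hy with hL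
  have hLs : ∀ v, (e.symm y v : E y) = L.symm v := fun v ↦ rfl
  have hLa : ∀ v : E y, (e ⟨y, v⟩).2 = L v := fun v ↦ rfl
  simp only [hLs] at hAR
  set ν : R.eigenspace 0 →ₗ[ℂ] R.eigenspace (-1) :=
    LinearMap.codRestrict _ (-(R ∘ₗ L.symm.toLinearMap ∘ₗ (deriv A 0).toLinearMap ∘ₗ
      L.toLinearMap ∘ₗ (R.eigenspace 0).subtype)) fun α ↦ by
        simp [hR] with hν
  have hνα : ∀ α, (ν α : E y) = -R (L.symm (deriv A 0 (L α))) := fun α ↦ rfl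
  have hker : ∀ α : R.eigenspace 0, R α = 0 := fun α ↦ by
    simpa [Module.End.mem_eigenspace_iff] using α.2
  have hAα : ∀ α : R.eigenspace 0, A 0 (L α) = 0 := fun α ↦ L.symm.injective <| by
    rw [hAR, L.symm_apply_apply, hker, map_zero]
  have hAA : ∀ w, A 0 (A 0 w) = -A 0 w := fun w ↦ L.symm.injective <| by simp [hAR, hR]
  refine ⟨(TensorProduct.mk ℂ _ _).flip (mvfderiv 𝓘(ℂ) φ y).toLinearMap ∘ₗ ν, ?_, ?_⟩
  · intro α U s hU hyU hs hsα
    refine ⟨_, h.extendsAt hA hφ hy hU hyU hs (by rw [hsα, hLa, hAα]), fun v ↦ ?_⟩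
    rw [hsα, hLa, hLs]
    set u := deriv (localRep e φ s) 0
    change mvfderiv 𝓘(ℂ) φ y v • L.symm (u + (deriv A 0 (L α) + A 0 u)) -
      ((mvfderiv 𝓘(ℂ) φ y v • ν α : R.eigenspace (-1)) : E y) ∈ _
    rw [Submodule.coe_smul, ← smul_sub]
    refine Submodule.smul_mem _ _ ?_
    rw [Module.End.mem_eigenspace_iff, hνα]
    simp [hAR, hR]
  · have key : ∀ α : R.eigenspace 0, (ν α : E y) = L.symm ((-A 0 * deriv A 0 * (1 + A 0)) (L α)) :=
      fun α ↦ by simp [hνα, hAα, hAR]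
    constructor
    · intro hρ
      obtain ⟨v, hv⟩ := hφ.exists_mvfderiv_eq_one
      have hν0 : ∀ α, ν α = 0 := fun α ↦ by
        have h1 : toHom y (ν α ⊗ₜ (mvfderiv 𝓘(ℂ) φ y).toLinearMap) v = 0 := by
          have := congr($hρ α)
          simp only [LinearMap.comp_apply, LinearMap.flip_apply, TensorProduct.mk_apply,
            LinearMap.zero_apply] at this
          rw [this]; simp
        rw [toHom_tmul] at h1
        simpa [hv] using h1
      ext w
      have hmem : L.symm ((1 + A 0) w) ∈ R.eigenspace 0 := by
        simp [hAR, hR]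
      have h1 := key ⟨_, hmem⟩
      rw [hν0] at h1
      simp only [ZeroMemClass.coe_zero, L.apply_symm_apply] at h1
      have h2 : (-A 0 * deriv A 0 * (1 + A 0)) w =
          (-A 0 * deriv A 0 * (1 + A 0)) ((1 + A 0) w) := by
        simp [hAA]
      rw [h2]
      exact L.symm.injective (by rw [← h1]; simp)
    · intro hN
      have hν0 : ν = 0 := LinearMap.ext fun α ↦ Subtype.ext <| by rw [key, hN]; simp
      rw [hν0, LinearMap.comp_zero]

end InducedHom

/-! ### Parallel transport around the singular point -/

/-- The logarithm `log r + 2πit` of the point `r e^{2πit}`, continuous along the circle. -/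
def logCircle (r t : ℝ) : ℂ := Real.log r + 2 * Real.pi * Complex.I * t

lemma exp_logCircle {r : ℝ} (hr : 0 < r) (t : ℝ) :
    Complex.exp (logCircle r t) = circleMap 0 r (2 * Real.pi * t) := by
  rw [logCircle, Complex.exp_add, ← Complex.ofReal_exp, Real.exp_log hr, circleMap, zero_add]
  congr 2
  push_cast
  ring

lemma norm_exp_logCircle {r : ℝ} (hr : 0 < r) (t : ℝ) : ‖Complex.exp (logCircle r t)‖ = r := by
  rw [exp_logCircle hr, norm_circleMap_zero, abs_of_pos hr]

lemma hasDerivAt_logCircle (r t : ℝ) :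
    HasDerivAt (logCircle r) (2 * Real.pi * Complex.I) t := by
  have h := ((hasDerivAt_id t).ofReal_comp.const_mul (2 * Real.pi * Complex.I)).const_add
    (Real.log r : ℂ)
  exact h.congr_deriv (by simp)

lemma logCircle_one (r : ℝ) : logCircle r 1 = logCircle r 0 + 2 * Real.pi * Complex.I := by
  simp [logCircle]

/-- Near `t₀`, the continuous logarithm along the circle is given by the principal branch. -/
lemma logCircle_add_log {r t t₀ : ℝ} (ht : |t - t₀| < 1 / 2) :
    logCircle r t₀ + Complex.log (Complex.exp (logCircle r t) / Complex.exp (logCircle r t₀)) =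
      logCircle r t := by
  rw [← Complex.exp_sub]
  have h : logCircle r t - logCircle r t₀ = (2 * Real.pi * (t - t₀) : ℝ) * Complex.I := by
    simp only [logCircle]
    push_cast
    ring
  have hπ := Real.pi_pos
  rw [abs_lt] at ht
  rw [Complex.log_exp]
  · ring
  · rw [h, Complex.im_ofReal_mul, Complex.I_im]
    nlinarith
  · rw [h, Complex.im_ofReal_mul, Complex.I_im]
    nlinarith

section Monodromy

variable {Y : Type*} [TopologicalSpace Y] [ChartedSpace ℂ Y] [IsManifold 𝓘(ℂ) ω Y]
  {F : Type*} [NormedAddCommGroup F] [NormedSpace ℂ F]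
  {E : Y → Type*} [TopologicalSpace (TotalSpace F E)]
  [∀ x, AddCommGroup (E x)] [∀ x, Module ℂ (E x)] [∀ x, TopologicalSpace (E x)]
  [∀ x, IsTopologicalAddGroup (E x)] [∀ x, ContinuousSMul ℂ (E x)]
  [FiberBundle F E] [VectorBundle ℂ F E] [ContMDiffVectorBundle ω F E 𝓘(ℂ)]
  {S : Finset Y} {φ : OpenPartialHomeomorph Y ℂ}
  {D : LogConnection F E S}
  {e : Trivialization F (TotalSpace.proj : TotalSpace F E → Y)} [MemTrivializationAtlas e]
  {A : ℂ → F →L[ℂ] F}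

/-- A section is flat at a point off `S` when it solves the differential equation given by the
connection matrix. -/
lemma LogConnection.IsConnectionMatrixAt.cov_eq_zero_iff {z : ℂ}
    (h : D.IsConnectionMatrixAt e φ A z) (hφ : φ ∈ IsManifold.maximalAtlas 𝓘(ℂ) ω Y)
    {s : Π x, E x} (hs : ContMDiffAt 𝓘(ℂ) (𝓘(ℂ).prod 𝓘(ℂ, F)) ω
      (fun x ↦ TotalSpace.mk' F x (s x)) (φ.symm z)) :
    D.D s (φ.symm z) = 0 ↔
      HasDerivAt (localRep e φ s) (-(z⁻¹ • A z (localRep e φ s z))) z := by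
  have hd := (analyticAt_localRep hφ e h.mem_target h.mem_baseSet hs).differentiableAt.hasDerivAt
  rw [h.cov_eq s (hs.mdifferentiableAt (by simp)), ← e.symmL_apply (R := ℂ) h.mem_baseSet]
  constructor
  · intro h0
    have h1 := congr($h0 (coordVec φ z))
    rw [ContinuousLinearMap.smulRight_apply, mvfderiv_coordVec hφ h.mem_target, one_smul,
      zero_apply] at h1
    have h2 := congrArg (e.continuousLinearMapAt ℂ (φ.symm z)) h1
    rw [e.continuousLinearMapAt_symmL h.mem_baseSet, map_zero] at h2
    rwa [eq_neg_of_add_eq_zero_left h2] at hd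
  · intro h0
    rw [h0.deriv, neg_add_cancel, map_zero]
    ext
    simp

variable [CompleteSpace F]

/-- A fundamental solution `Φ`, as a function of `w = log z`, describes all parallel sections along
a circle around the singular point. -/
lemma LogConnection.IsParallelAlong.apply_one {ρ r : ℝ} {Φ : ℂ → F →L[ℂ] F} (hr : 0 < r)
    (hrρ : r < ρ) (hφ : φ ∈ IsManifold.maximalAtlas 𝓘(ℂ) ω Y)
    (hA : ∀ z, z ≠ 0 → ‖z‖ < ρ → D.IsConnectionMatrixAt e φ A z)
    (hΦ : ∀ z, z ≠ 0 → ‖z‖ < ρ → ∀ w, Complex.exp w = z →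
      IsUnit (Φ w) ∧ HasDerivAt Φ (-(A z * Φ w)) w)
    {σ : ℝ → TotalSpace F E} (hσ : D.IsParallelAlong (circleLoop φ r) σ) :
    (e (σ 1)).2 = Φ (logCircle r 1) (Ring.inverse (Φ (logCircle r 0)) (e (σ 0)).2) := by
  have hz : ∀ t, Complex.exp (logCircle r t) ≠ 0 := fun t ↦ Complex.exp_ne_zero _
  have hzρ : ∀ t, ‖Complex.exp (logCircle r t)‖ < ρ := fun t ↦ by rwa [norm_exp_logCircle hr]
  set h : ℝ → F := fun t ↦ Ring.inverse (Φ (logCircle r t)) (e (σ t)).2 with hh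
  have hderiv : ∀ t₀ ∈ Set.Icc (0 : ℝ) 1, HasDerivWithinAt h 0 (Set.Icc 0 1) t₀ := by
    intro t₀ ht₀
    obtain ⟨U, s, hU, htU, hs, hσs⟩ := hσ t₀ ht₀
    set w₀ := logCircle r t₀ with hw₀
    have hγ : φ.symm (Complex.exp w₀) = circleLoop φ r t₀ := by
      rw [hw₀, exp_logCircle hr]; rfl
    have hM := hA _ (hz t₀) (hzρ t₀)
    obtain ⟨hu, hΦ'⟩ := hΦ _ (hz t₀) (hzρ t₀) w₀ rfl
    have hf := (hM.cov_eq_zero_iff hφ (hs.hol.contMDiffAt (hU.mem_nhds (hγ ▸ htU)))).1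
      (hs.flat _ (hγ ▸ htU))
    have hk : HasDerivAt (fun w ↦ Ring.inverse (Φ w) (localRep e φ s (Complex.exp w))) 0 w₀ := by
      have h1 := (HasDerivAt.ringInverse_of_isUnit hu hΦ').clm_apply
        (hf.scomp w₀ (Complex.hasDerivAt_exp w₀))
      refine h1.congr_deriv ?_
      rw [smul_neg, smul_inv_smul₀ (Complex.exp_ne_zero _), map_neg]
      exact add_neg_cancel _
    have hk' := (hk.scomp t₀ (hasDerivAt_logCircle r t₀)).hasDerivWithinAt (s := Set.Icc 0 1)
    rw [smul_zero] at hk'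
    have heq : ∀ t, σ t = TotalSpace.mk' F (circleLoop φ r t) (s (circleLoop φ r t)) →
        h t = ((fun w ↦ Ring.inverse (Φ w) (localRep e φ s (Complex.exp w))) ∘ logCircle r) t :=
      fun t ht ↦ by
        simp only [hh, ht, Function.comp, localRep]
        rw [exp_logCircle hr]
        rfl
    exact hk'.congr_of_eventuallyEq (hσs.mono heq) (heq _ (hσs.self_of_nhdsWithin ht₀))
  have h10 := constant_of_derivWithin_zero (fun t ht ↦ (hderiv t ht).differentiableWithinAt)
    (fun t ht ↦ (hderiv t (Set.Ico_subset_Icc_self ht)).derivWithin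
      (uniqueDiffOn_Icc zero_lt_one t (Set.Ico_subset_Icc_self ht))) 1 (by simp)
  have h2 : Φ (logCircle r 1) (h 1) = (e (σ 1)).2 :=
    congr($(Ring.mul_inverse_cancel _ (hΦ _ (hz 1) (hzρ 1) _ rfl).1) (e (σ 1)).2)
  rw [← h2, h10]

/-- The columns of a fundamental solution are parallel sections along the circles around the
singular point. -/
lemma isParallelAlong_circleLoop {ρ r : ℝ} {Φ : ℂ → F →L[ℂ] F} (hr : 0 < r)
    (hrρ : r < ρ) (hφ : φ ∈ IsManifold.maximalAtlas 𝓘(ℂ) ω Y)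
    (hA : ∀ z, z ≠ 0 → ‖z‖ < ρ → D.IsConnectionMatrixAt e φ A z)
    (hΦ : ∀ z, z ≠ 0 → ‖z‖ < ρ → ∀ w, Complex.exp w = z → HasDerivAt Φ (-(A z * Φ w)) w) (v : F) :
    D.IsParallelAlong (circleLoop φ r) fun t ↦
      TotalSpace.mk' F (circleLoop φ r t) (e.symm _ (Φ (logCircle r t) v)) := by
  intro t₀ _
  set z₀ := Complex.exp (logCircle r t₀) with hz₀
  have hz₀0 : z₀ ≠ 0 := Complex.exp_ne_zero _
  -- The local flat section uses the branch of the logarithm at `z₀` with the right value there.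
  set V : Set ℂ := {z | z ≠ 0 ∧ ‖z‖ < ρ ∧ z / z₀ ∈ Complex.slitPlane} with hV
  have hVo : IsOpen V := isOpen_ne.inter ((isOpen_lt continuous_norm continuous_const).inter
    (Complex.isOpen_slitPlane.preimage (continuous_id.div_const z₀)))
  have hVt : ∀ t : ℝ, Complex.exp (logCircle r t) / z₀ ∈ Complex.slitPlane →
      Complex.exp (logCircle r t) ∈ V :=
    fun t ht ↦ ⟨Complex.exp_ne_zero _, by rwa [norm_exp_logCircle hr], ht⟩
  set l : ℂ → ℂ := fun z ↦ logCircle r t₀ + Complex.log (z / z₀) with hl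
  have hexp : ∀ z ∈ V, Complex.exp (l z) = z := fun z hz ↦ by
    rw [hl, Complex.exp_add, Complex.exp_log (div_ne_zero hz.1 hz₀0), mul_div_cancel₀ _ hz₀0]
  have hl' : ∀ z ∈ V, HasDerivAt l z⁻¹ z := fun z hz ↦ by
    have := (((hasDerivAt_id z).div_const z₀).clog hz.2.2).const_add (logCircle r t₀)
    refine this.congr_deriv ?_
    have := hz.1
    simp only [id]
    field_simp
  set g : ℂ → F := fun z ↦ Φ (l z) v with hg
  have hg' : ∀ z ∈ V, HasDerivAt g (-(z⁻¹ • A z (g z))) z := fun z hz ↦ by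
    have h1 := (hΦ z hz.1 hz.2.1 _ (hexp z hz)).scomp z (hl' z hz)
    refine (h1.clm_apply (hasDerivAt_const z v)).congr_deriv ?_
    simp [hg]
  have hgan : ∀ z ∈ V, AnalyticAt ℂ g z := fun z hz ↦
    DifferentiableOn.analyticAt (fun z hz ↦ (hg' z hz).differentiableAt.differentiableWithinAt)
      (hVo.mem_nhds hz)
  have hMV : ∀ z ∈ V, D.IsConnectionMatrixAt e φ A z := fun z hz ↦ hA z hz.1 hz.2.1
  have hγ : ∀ t, circleLoop φ r t = φ.symm (Complex.exp (logCircle r t)) := fun t ↦ by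
    rw [exp_logCircle hr]; rfl
  have hrep : ∀ z ∈ V, φ.symm z ∈ φ.source ∩ φ ⁻¹' V := fun z hz ↦
    ⟨φ.map_target (hMV z hz).mem_target, by
      rwa [Set.mem_preimage, φ.right_inv (hMV z hz).mem_target]⟩
  have hUV : ∀ x ∈ φ.source ∩ φ ⁻¹' V, ∃ z ∈ V, φ.symm z = x := fun x hx ↦
    ⟨φ x, hx.2, φ.left_inv hx.1⟩
  have hhol : ∀ x ∈ φ.source ∩ φ ⁻¹' V, ContMDiffAt 𝓘(ℂ) (𝓘(ℂ).prod 𝓘(ℂ, F)) ω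
      (fun x ↦ TotalSpace.mk' F x (e.symm x (g (φ x)))) x := fun x hx ↦ by
    have hxe : x ∈ e.baseSet := by
      obtain ⟨z, hz, rfl⟩ := hUV x hx
      exact (hMV z hz).mem_baseSet
    exact contMDiffAt_symm_section hφ e hx.1 hxe (hgan _ hx.2)
  refine ⟨φ.source ∩ φ ⁻¹' V, fun x ↦ e.symm x (g (φ x)), φ.isOpen_inter_preimage hVo, ?_,
    ⟨?_, fun x hx ↦ (hhol x hx).contMDiffWithinAt, fun x hx ↦ ?_⟩, ?_⟩
  · rw [hγ]
    exact hrep _ (hVt _ (by rw [div_self hz₀0]; exact Complex.one_mem_slitPlane))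
  · refine Set.disjoint_left.2 fun x hx ↦ ?_
    obtain ⟨z, hz, rfl⟩ := hUV x hx
    exact (hMV z hz).notMem
  · have hx' := hhol x hx
    obtain ⟨z, hz, rfl⟩ := hUV x hx
    rw [(hMV z hz).cov_eq_zero_iff hφ hx']
    have heq : ∀ z ∈ V, localRep e φ (fun x ↦ e.symm x (g (φ x))) z = g z := fun z hz ↦ by
      rw [localRep, e.apply_mk_symm (hMV z hz).mem_baseSet, φ.right_inv (hMV z hz).mem_target]
    rw [heq z hz]
    exact (hg' z hz).congr_of_eventuallyEq (eventually_of_mem (hVo.mem_nhds hz) heq)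
  · refine nhdsWithin_le_nhds ?_
    have hcont : Tendsto (fun t ↦ Complex.exp (logCircle r t) / z₀) (𝓝 t₀) (𝓝 1) := by
      have h1 : ContinuousAt (fun t ↦ Complex.exp (logCircle r t) / z₀) t₀ :=
        ((hasDerivAt_logCircle r t₀).continuousAt.cexp).div_const z₀
      rwa [ContinuousAt, ← hz₀, div_self hz₀0] at h1
    filter_upwards [hcont (Complex.isOpen_slitPlane.mem_nhds Complex.one_mem_slitPlane),
      Metric.ball_mem_nhds t₀ (by norm_num : (0 : ℝ) < 1 / 2)] with t ht htb
    rw [Metric.mem_ball, Real.dist_eq] at htb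
    have h1 : φ (circleLoop φ r t) = Complex.exp (logCircle r t) := by
      rw [hγ, φ.right_inv (hMV _ (hVt t ht)).mem_target]
    rw [h1, hg]
    simp only [hl, hz₀, logCircle_add_log htb]

/-- Parallel transport once around the singular point: it exists, is unique, and is trivial if and
only if the nilpotent part `N` of the monodromy of a fundamental solution vanishes. -/
theorem monodromy_circleLoop {ρ r : ℝ} {Φ : ℂ → F →L[ℂ] F} {N : F →L[ℂ] F} (hr : 0 < r)
    (hrρ : r < ρ) (hφ : φ ∈ IsManifold.maximalAtlas 𝓘(ℂ) ω Y)
    (hA : ∀ z, z ≠ 0 → ‖z‖ < ρ → D.IsConnectionMatrixAt e φ A z)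
    (hΦ : ∀ z, z ≠ 0 → ‖z‖ < ρ → ∀ w, Complex.exp w = z →
      IsUnit (Φ w) ∧ HasDerivAt Φ (-(A z * Φ w)) w)
    (hN : ∀ w, Φ (w + 2 * Real.pi * Complex.I) =
      Φ w * (1 - (2 * Real.pi * Complex.I : ℂ) • N)) :
    (∃! T : E (circleLoop φ r 0) →ₗ[ℂ] E (circleLoop φ r 0), D.IsMonodromy (circleLoop φ r) T) ∧
      ∀ T : E (circleLoop φ r 0) →ₗ[ℂ] E (circleLoop φ r 0),
        D.IsMonodromy (circleLoop φ r) T → (T = LinearMap.id ↔ N = 0) := by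
  have hγ : circleLoop φ r 0 = φ.symm (Complex.exp (logCircle r 0)) := by
    rw [exp_logCircle hr]; rfl
  have hz0 : Complex.exp (logCircle r 0) ≠ 0 := Complex.exp_ne_zero _
  have hzρ : ‖Complex.exp (logCircle r 0)‖ < ρ := by rwa [norm_exp_logCircle hr]
  have hγe : circleLoop φ r 0 ∈ e.baseSet := hγ ▸ (hA _ hz0 hzρ).mem_baseSet
  have hu := (hΦ _ hz0 hzρ _ rfl).1
  set L := e.continuousLinearEquivAt ℂ (circleLoop φ r 0) hγe with hL
  have hLs : ∀ v, (e.symm (circleLoop φ r 0) v : E (circleLoop φ r 0)) = L.symm v := fun v ↦ rfl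
  have hLa : ∀ v : E (circleLoop φ r 0), (e ⟨circleLoop φ r 0, v⟩).2 = L v := fun v ↦ rfl
  set Ψ : F →L[ℂ] F := Ring.inverse (Φ (logCircle r 0)) with hΨ
  have hinv : ∀ v, Φ (logCircle r 0) (Ψ v) = v := fun v ↦
    congr($(Ring.mul_inverse_cancel _ hu) v)
  have hinv' : ∀ v, Ψ (Φ (logCircle r 0) v) = v := fun v ↦
    congr($(Ring.inverse_mul_cancel _ hu) v)
  have hmon : ∀ T, D.IsMonodromy (circleLoop φ r) T →
      ∀ v, T v = L.symm (Φ (logCircle r 1) (Ψ (L v))) := fun T hT v ↦ by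
    obtain ⟨σ, hσ, h0, h1⟩ := hT v
    have := hσ.apply_one hr hrρ hφ hA hΦ
    rw [h0, h1] at this
    rw [← hLa v, ← this]
    exact (L.symm_apply_apply _).symm
  refine ⟨⟨L.symm.toLinearMap ∘ₗ (Φ (logCircle r 1)).toLinearMap ∘ₗ Ψ.toLinearMap ∘ₗ
    L.toLinearMap, fun v ↦ ⟨_, isParallelAlong_circleLoop hr hrρ hφ hA
      (fun z h0 h1 w hw ↦ (hΦ z h0 h1 w hw).2) (Ψ (L v)), ?_, ?_⟩, fun T hT ↦ ?_⟩, fun T hT ↦ ?_⟩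
  · rw [hinv, hLs, L.symm_apply_apply]
  · have h10 : circleLoop φ r 1 = circleLoop φ r 0 := by simp [circleLoop, circleMap]
    rw [h10]
    rfl
  · exact LinearMap.ext fun v ↦ hmon T hT v
  · have hT' : ∀ v, T v = L.symm (L v - Φ (logCircle r 0)
        ((2 * Real.pi * Complex.I : ℂ) • N (Ψ (L v)))) := fun v ↦ by
      rw [hmon T hT, logCircle_one, hN]
      change L.symm (Φ (logCircle r 0) ((1 - (2 * Real.pi * Complex.I : ℂ) • N) (Ψ (L v)))) = _
      rw [sub_apply, one_apply_eq_self, map_sub, hinv, smul_apply]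
    constructor
    · intro hid
      have hc : (2 * Real.pi * Complex.I : ℂ) ≠ 0 := Complex.two_pi_I_ne_zero
      ext u
      have h1 := hT' (L.symm (Φ (logCircle r 0) u))
      rw [hid, L.apply_symm_apply, hinv', LinearMap.id_apply, L.symm.injective.eq_iff, eq_comm,
        sub_eq_self] at h1
      have h2 := congrArg Ψ h1
      rw [hinv', map_zero] at h2
      exact (smul_eq_zero.1 h2).resolve_left hc
    · rintro rfl
      exact LinearMap.ext fun v ↦ by rw [hT']; simp

end Monodromy

/-! ### Residues with eigenvalues `0` and `-1` -/

/-- An endomorphism of a plane with eigenvalues `0` and `-1` satisfies `R² = -R`. -/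
lemma apply_apply_eq_neg_of_hasEigenvalue {V : Type*} [AddCommGroup V] [Module ℂ V]
    (hV : Module.finrank ℂ V = 2) {R : Module.End ℂ V} (h0 : R.HasEigenvalue 0)
    (h1 : R.HasEigenvalue (-1)) (v : V) : R (R v) = -R v := by
  obtain ⟨v₀, h₀⟩ := h0.exists_hasEigenvector
  obtain ⟨v₁, h₁⟩ := h1.exists_hasEigenvector
  have hli : LinearIndependent ℂ ![v₀, v₁] := by
    refine Module.End.eigenvectors_linearIndependent' R ![0, -1] ?_ _ ?_
    · intro i j hij
      fin_cases i <;> fin_cases j <;> simp_all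
    · intro i
      fin_cases i
      exacts [h₀, h₁]
  set b := basisOfLinearIndependentOfCardEqFinrank hli (by simp [hV])
  have h : R ∘ₗ R = -R := b.ext fun i ↦ by
    have e0 := h₀.apply_eq_smul
    have e1 := h₁.apply_eq_smul
    fin_cases i <;> simp_all [b]
  exact congr($h v)

/-- A residue with a nonzero eigenvalue is not the junk value of `LogConnection.residue`. -/
lemma LogConnection.isResidue_residue {Y : Type*} [TopologicalSpace Y] [ChartedSpace ℂ Y]
    [IsManifold 𝓘(ℂ) ω Y] {F : Type*} [NormedAddCommGroup F] [NormedSpace ℂ F]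
    {E : Y → Type*} [TopologicalSpace (TotalSpace F E)]
    [∀ x, AddCommGroup (E x)] [∀ x, Module ℂ (E x)] [∀ x, TopologicalSpace (E x)]
    [∀ x, IsTopologicalAddGroup (E x)] [∀ x, ContinuousSMul ℂ (E x)]
    [FiberBundle F E] [VectorBundle ℂ F E] {S : Finset Y} {y : Y}
    (D : LogConnection F E S) {μ : ℂ} (hμ : μ ≠ 0) (h : (D.residue y).HasEigenvalue μ) :
    D.IsResidue y (D.residue y) := by
  unfold residue at h ⊢
  split_ifs at h ⊢ with hR
  · exact hR.choose_spec
  · obtain ⟨v, hv⟩ := h.exists_hasEigenvector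
    have := hv.apply_eq_smul
    rw [LinearMap.zero_apply, eq_comm, smul_eq_zero] at this
    exact absurd this (by simp [hμ, hv.2])

end LogConn

end

theorem proposition5p2
    {Y : Type*} [TopologicalSpace Y] [T2Space Y] [ConnectedSpace Y] [ChartedSpace ℂ Y]
    [IsManifold 𝓘(ℂ) ω Y]
    {F : Type*} [NormedAddCommGroup F] [NormedSpace ℂ F] (hF : Module.finrank ℂ F = 2)
    {E : Y → Type*} [TopologicalSpace (TotalSpace F E)]
    [∀ x, AddCommGroup (E x)] [∀ x, Module ℂ (E x)] [∀ x, TopologicalSpace (E x)]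
    [∀ x, IsTopologicalAddGroup (E x)] [∀ x, ContinuousSMul ℂ (E x)]
    [FiberBundle F E] [VectorBundle ℂ F E] [ContMDiffVectorBundle ω F E 𝓘(ℂ)]
    (S : Finset Y) (y : Y) (hy : y ∈ S)
    (D : LogConn.LogConnection F E S)
    (h_zero : (D.residue y).HasEigenvalue 0) (h_neg_one : (D.residue y).HasEigenvalue (-1))
    (ℓ₀ ℓ₁ : Submodule ℂ (E y))
    (hℓ₀ : ℓ₀ = (D.residue y).eigenspace 0) (hℓ₁ : ℓ₁ = (D.residue y).eigenspace (-1)) :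
    ∃ ρ : ℓ₀ →ₗ[ℂ] ℓ₁ ⊗[ℂ] LogConn.Cotangent y,
      D.InducesHom y ℓ₀ ℓ₁ ρ ∧
      (∀ ρ' : ℓ₀ →ₗ[ℂ] ℓ₁ ⊗[ℂ] LogConn.Cotangent y, D.InducesHom y ℓ₀ ℓ₁ ρ' → ρ' = ρ) ∧
      ∀ φ : OpenPartialHomeomorph Y ℂ, LogConn.IsCoordAt φ y →
        ∀ᶠ r : ℝ in 𝓝[>] 0,
          (∃! T : E (LogConn.circleLoop φ r 0) →ₗ[ℂ] E (LogConn.circleLoop φ r 0),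
            D.IsMonodromy (LogConn.circleLoop φ r) T) ∧
          ∀ T : E (LogConn.circleLoop φ r 0) →ₗ[ℂ] E (LogConn.circleLoop φ r 0),
            D.IsMonodromy (LogConn.circleLoop φ r) T → (T = LinearMap.id ↔ ρ = 0) := by
  have hfin : FiniteDimensional ℂ F := Module.finite_of_finrank_pos (by omega)
  have hcomplete : CompleteSpace F := FiniteDimensional.complete ℂ F
  subst hℓ₀ hℓ₁
  set e := trivializationAt F E y
  have hye : y ∈ e.baseSet := FiberBundle.mem_baseSet_trivializationAt' y
  set L := e.continuousLinearEquivAt ℂ y hye with hL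
  have hR := D.isResidue_residue (by norm_num) h_neg_one
  have hRR := LogConn.apply_apply_eq_neg_of_hasEigenvalue
    (L.toLinearEquiv.finrank_eq.trans hF) h_zero h_neg_one
  have hdisj : Disjoint ((D.residue y).eigenspace 0) ((D.residue y).eigenspace (-1)) :=
    Submodule.disjoint_def.2 fun v h0 h1 ↦ by
      rw [Module.End.mem_eigenspace_iff] at h0 h1
      rw [h0, zero_smul] at h1
      simpa using h1.symm
  obtain ⟨φ₀, hφ₀⟩ := LogConn.exists_isCoordAt y
  obtain ⟨A₀, hA₀, hAR₀, hD₀⟩ := D.exists_hasConnectionMatrix hR hφ₀ e hye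
  obtain ⟨ρ, hρ, -⟩ := hD₀.exists_inducesHom hA₀ hφ₀ hye hAR₀ hRR
  refine ⟨ρ, hρ, fun ρ' hρ' ↦ hρ'.unique hdisj hρ, fun φ hφ ↦ ?_⟩
  obtain ⟨A, hA, hAR, hD⟩ := D.exists_hasConnectionMatrix hR hφ e hye
  obtain ⟨ρ', hρ', hρN⟩ := hD.exists_inducesHom hA hφ hye hAR hRR
  obtain rfl := hρ'.unique hdisj hρ
  have hA0 : A 0 * A 0 = -A 0 := by
    ext v
    refine L.symm.injective ?_
    have hAR' : ∀ v, L.symm (A 0 v) = D.residue y (L.symm v) := hAR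
    change L.symm (A 0 (A 0 v)) = L.symm (-A 0 v)
    rw [hAR', hAR', hRR, map_neg, hAR']
  obtain ⟨Φ, hΦ, hΦN⟩ := LogConn.exists_fundamentalSolution hA hA0
  obtain ⟨δ, hδ, hball⟩ := Metric.eventually_nhds_iff.1 ((eventually_nhdsWithin_iff.1 hD).and hΦ)
  simp only [dist_zero_right] at hball
  filter_upwards [Ioo_mem_nhdsGT hδ] with r hr
  have := LogConn.monodromy_circleLoop hr.1 hr.2 hφ.mem_atlas
    (fun z h0 h1 ↦ (hball h1).1 h0) (fun z _ h1 ↦ (hball h1).2) hΦN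
  exact ⟨this.1, fun T hT ↦ (this.2 T hT).trans hρN.symm⟩
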